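/- **Codings.** Let $\langle x,y\rangle=\frac12(x^2+2xy+y^2+3x+y)$ be Cantor's pairing function on $\mathbb N=\{0,1,2,\dots\}$, put $\langle x_1\rangle=x_1$ and $\langle x_1,\dots,x_n\rangle=\langle\langle x_1,\dots,x_{n-1}\rangle,x_n\rangle$, and let $\pi^n_i\langle x_1,\dots,x_n\rangle=x_i$. An integer $i$ is coded by $\zeta(i)=-2i-1$ if $i<0$ and $\zeta(i)=2i$ if $i\ge 0$; a rational $q=a/b$ in lowest terms ($b>0$) is coded by $\rho(q)=\zeta\bigl((\operatorname{sgn}a)\prod_p p^{\zeta(v_p(a)-v_p(b))}\bigr)$ (product over all primes; $\rho(0)=0$). For rationals $a,b$ let $\iota\langle\rho(a),\rho(b)\rangle=\{x\in\mathbb R: a<x<b\}$. **Effective topologies.** An effective topology $(\mathcal B,\nu)$ on a set $X$ consists of a countable basis $\mathcal B$ of a $T_0$ topology on $X$ and a map $\nu$ on $\mathbb N$ such that every member of $\mathcal B$ is $\nu(n)$ for some $n$; put $\operatorname{dom}\nu=\{n:\nu(n)\in\mathcal B\}$. A local basis for $x\in X$ is a set $\mathcal L\subseteq\mathcal B$ all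 of whose members contain $x$ and such that every $B\in\mathcal B$ with $x\in B$ includes some $L\in\mathcal L$. A function $\phi:\mathbb N\to\operatorname{dom}\nu$ is an oracle for $x$ if $\{\nu(\phi(n)):n\in\mathbb N\}$ is a local basis for $x$; it is nested if $\nu(\phi(n+1))\subseteq\nu(\phi(n))$ for all $n$. A set $R\subseteq\operatorname{dom}\nu$ is a basic representation of $A\subseteq X$ if, for all $x\in X$: $x\in A$ if and only if some local basis $\mathcal L$ for $x$ satisfies $\mathcal L\subseteq\nu(R)$. The effective product of $(\mathcal B_1,\nu_1),\dots,(\mathcal B_n,\nu_n)$ has the basis of all $B_1\times\dots\times B_n$ with $B_i\in\mathcal B_i$, and the coding $\nu\langle a_1,\dots,a_n\rangle=\nu_1(a_1)\times\dots\times\nu_n(a_n)$. Let $\mathcal I$ be the set of all open intervals $(a,b)$ with rational $a<b$. For a rational $c>0$ let $\mathcal I_{10,c}$ be the set of all open intervals $\bigl(\frac{m-c}{10^d},\frac{m+1+c}{10^d}\bigr)$ with $m\in\mathbb Z$ and $d$ a positive integer. Both $(\mathcal I,\iota)$ and $(\mathcal I_{10,c},\iota)$ are effective topologies on $\mathbb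 R$. **Physical models.** A physical model $(S,A)$ is a set $S$ of states with a set $A$ of functions on states (observable quantities). It is isomorphic to $(T,B)$ if there are bijections $f:S\to T$ and $g:A\to B$ with $\alpha(s)=g(\alpha)(f(s))$ for all $s\in S$, $\alpha\in A$. It is a computable physical model if $S\subseteq\mathbb N$ is recursive and every member of $A$ is a total recursive function $\mathbb N\to\mathbb N$. For $n>k$, the model is induced by $\psi:\mathbb R^k\to\mathbb R^{n-k}$ if $S\subseteq\mathbb R^n$ is the graph of $\psi$ and $A$ is the set of the $n$ coordinate projections on $\mathbb R^n$. A basic representation of such a model in an effective product of effective topologies on $n$ copies of $\mathbb R$ is a pair $(R,H)$ in which $R$ is a basic representation of $S$ in that product and $H=\{\pi^n_1,\dots,\pi^n_n\}$. **Kreisel's criterion.** The model satisfies Kreisel's criterion on $\mathbb R^k$ if it is induced by some $\psi:\mathbb R^k\to\mathbb R^{n-k}$, $n>k$, and for each $j\in\{1,\dots,n-k\}$ there is a partial recursive functional $\kappa_j$ (computed by a program with $k$ function oracles) such that, whenever $\phi_1,\dots,\phi_k$ are nested oracles for real numbers $x_1,\dots,x_k$ in $(\mathcal I,\iota)$, the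 value $\kappa_j(\phi_1,\dots,\phi_k,l)$ is defined for all $l\in\mathbb N$ and $l\mapsto\kappa_j(\phi_1,\dots,\phi_k,l)$ is a nested oracle in $(\mathcal I,\iota)$ for the $j$-th coordinate of $\psi(x_1,\dots,x_k)$. **Theorem.** Let $n>k\ge 0$ be integers and let $c>0$ be rational. If a physical model $(S,A)$ with $S\subseteq\mathbb R^n$ satisfies Kreisel's criterion on $\mathbb R^k$, then it has a basic representation $(R,H)$, in the effective product of $n$ copies of $(\mathcal I_{10,c},\iota)$, that is isomorphic to a computable physical model. Moreover this holds uniformly: for fixed $k,n,c$ there is an algorithm that, given programs for any functionals $\kappa_1,\dots,\kappa_{n-k}$ which witness Kreisel's criterion for a model $(S,A)$, outputs a program whose domain is the set $R$ of states of such a basic representation $(R,H)$, a program that computes the characteristic function of the set $T$ of states of a computable physical model $(T,B)$, and, for $i=1,\dots,n$, a program that computes $\beta_i\in B$, where some isomorphism from $(R,H)$ to $(T,B)$ maps $\pi^n_i$ to $\beta_i$ for every $i$. -/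

import Mathlib

namespace CPM

/-! ### Codings by non-negative integers -/

/-- Cantor's pairing function `⟨x, y⟩ = (x² + 2xy + y² + 3x + y) / 2`. The division is exact. -/
def cantorPair (x y : ℕ) : ℕ := (x ^ 2 + 2 * x * y + y ^ 2 + 3 * x + y) / 2

theorem two_mul_cantorPair (x y : ℕ) :
    2 * cantorPair x y = (x + y) * (x + y + 1) + 2 * x := by
  have h : x ^ 2 + 2 * x * y + y ^ 2 + 3 * x + y = (x + y) * (x + y + 1) + 2 * x := by ring
  have h2 : 2 ∣ (x + y) * (x + y + 1) + 2 * x :=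
    (Nat.even_mul_succ_self (x + y)).two_dvd.add (Dvd.intro _ rfl)
  unfold cantorPair
  rw [h]
  exact Nat.mul_div_cancel' h2

theorem cantorPair_injective {a b x y : ℕ} (h : cantorPair a b = cantorPair x y) :
    a = x ∧ b = y := by
  have h1 := two_mul_cantorPair a b
  have h2 := two_mul_cantorPair x y
  rw [h] at h1
  have hs : a + b = x + y := by
    rcases lt_trichotomy (a + b) (x + y) with hlt | heq | hgt
    · nlinarith
    · exact heq
    · nlinarith
  rw [hs] at h1
  omega

/-- The code `⟨x₁, …, xₙ⟩ = ⟨⟨x₁, …, xₙ₋₁⟩, xₙ⟩` of a sequence of length `n ≥ 1`,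
where `⟨x₁⟩ = x₁`. -/
def seqCode : {n : ℕ} → (Fin n → ℕ) → ℕ
  | 0, _ => 0
  | 1, x => x 0
  | _ + 2, x => cantorPair (seqCode (Fin.init x)) (x (Fin.last _))

theorem seqCode_injective : ∀ n : ℕ, Function.Injective (seqCode (n := n))
  | 0 => fun x y _ => funext fun i => i.elim0
  | 1 => fun x y h => funext fun i => by
      rw [Subsingleton.elim i 0]; exact h
  | n + 2 => fun x y h => by
      obtain ⟨h1, h2⟩ := cantorPair_injective h
      have h3 := seqCode_injective (n + 1) h1
      rw [← Fin.snoc_init_self x, ← Fin.snoc_init_self y, h3, h2]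

/-- The projection function `πᵢⁿ`, with `πᵢⁿ⟨x₁, …, xₙ⟩ = xᵢ`. For `n ≥ 1` every non-negative
integer is the code of exactly one sequence of length `n`. -/
noncomputable def seqProj {n : ℕ} (i : Fin n) (s : ℕ) : ℕ :=
  Function.invFun (seqCode (n := n)) s i

theorem seqProj_seqCode {n : ℕ} (i : Fin n) (x : Fin n → ℕ) : seqProj i (seqCode x) = x i := by
  unfold seqProj
  rw [Function.leftInverse_invFun (seqCode_injective n) x]

/-- The code of an integer: `ζ(i) = -2i - 1` for `i < 0` and `ζ(i) = 2i` for `i ≥ 0`. -/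
def zeta (i : ℤ) : ℕ := if i < 0 then (-2 * i - 1).toNat else (2 * i).toNat

/-- The code of a rational number `q = a / b` in lowest terms:
`ρ(q) = ζ((sgn a) ∏ₚ p ^ ζ(vₚ(a) - vₚ(b)))`, the product being over all primes `p`
(only those dividing `a` or `b` contribute a factor other than `1`). -/
def rho (q : ℚ) : ℕ :=
  zeta (q.num.sign *
    ∏ p ∈ (q.num.natAbs * q.den).primeFactors, (p : ℤ) ^ zeta (padicValRat p q))

/-- The code `⟨ρ(a), ρ(b)⟩` of a pair of rational numbers. -/
def ratPair (a b : ℚ) : ℕ := cantorPair (rho a) (rho b)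

/-! ### Effective topologies and oracles -/

/-- A pair `(B, ν)` consisting of a family `B` of subsets of `X` and a map `ν` that
assigns a subset of `X` to each non-negative integer. -/
structure CodedBasis (X : Type) where
  basis : Set (Set X)
  coding : ℕ → Set X

namespace CodedBasis

variable {X : Type}

/-- The domain of the coding: the integers that encode members of the family. -/
def dom (τ : CodedBasis X) : Set ℕ := {n | τ.coding n ∈ τ.basis}

/-- `(B, ν)` is an effective topology on `X`: `B` is a basis of some T₀ topology on `X`
and every member of `B` has a code (so that `B` is countable). -/
def IsEffectiveTopology (τ : CodedBasis X) : Prop :=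
  (∃ t : TopologicalSpace X,
    @TopologicalSpace.IsTopologicalBasis X t τ.basis ∧ @T0Space X t) ∧
  τ.basis ⊆ Set.range τ.coding

/-- `L` is a local basis for the point `x`. -/
def IsLocalBasis (τ : CodedBasis X) (x : X) (L : Set (Set X)) : Prop :=
  L ⊆ τ.basis ∧ (∀ U ∈ L, x ∈ U) ∧ ∀ V ∈ τ.basis, x ∈ V → ∃ U ∈ L, U ⊆ V

/-- `φ` is an oracle for the point `x`. -/
def IsOracle (τ : CodedBasis X) (φ : ℕ → ℕ) (x : X) : Prop :=
  (∀ n, φ n ∈ τ.dom) ∧ τ.IsLocalBasis x (τ.coding '' Set.range φ)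

/-- `φ` is a nested oracle for the point `x`. -/
def IsNestedOracle (τ : CodedBasis X) (φ : ℕ → ℕ) (x : X) : Prop :=
  τ.IsOracle φ x ∧ ∀ n, τ.coding (φ (n + 1)) ⊆ τ.coding (φ n)

/-- The set `R` of non-negative integers is a basic representation of `A ⊆ X`. -/
def IsBasicRepresentation (τ : CodedBasis X) (R : Set ℕ) (A : Set X) : Prop :=
  R ⊆ τ.dom ∧ ∀ x, x ∈ A ↔ ∃ L, τ.IsLocalBasis x L ∧ L ⊆ τ.coding '' R

/-- The effective product of `n` coded bases, with basis the products `B₁ × ⋯ × Bₙ` of basis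
elements and coding `ν⟨a₁, …, aₙ⟩ = ν₁(a₁) × ⋯ × νₙ(aₙ)`. -/
def product {n : ℕ} (τ : Fin n → CodedBasis X) : CodedBasis (Fin n → X) where
  basis := {U | ∃ V : Fin n → Set X, (∀ i, V i ∈ (τ i).basis) ∧ U = Set.univ.pi V}
  coding s := Set.univ.pi fun i => (τ i).coding (seqProj i s)

end CodedBasis

/-- The coding `ι` of open intervals with rational end points: the code `⟨ρ(a), ρ(b)⟩`
stands for `{x | a < x < b}`. -/
def iota (s : ℕ) : Set ℝ := {x | ∃ a b : ℚ, s = ratPair a b ∧ (a : ℝ) < x ∧ x < (b : ℝ)}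

/-- The rational intervals `(I, ι)`. -/
def rationalIntervals : CodedBasis ℝ where
  basis := {U | ∃ a b : ℚ, a < b ∧ U = Set.Ioo (a : ℝ) (b : ℝ)}
  coding := iota

/-- The decimal intervals with accuracy factor `c`: the intervals with end points
`(m - c) / 10ⁿ` and `(m + 1 + c) / 10ⁿ` for an integer `m` and a positive integer `n`,
with the coding `ι`. -/
def decimalIntervals (c : ℚ) : CodedBasis ℝ where
  basis := {U | ∃ (m : ℤ) (n : ℕ), 0 < n ∧
    U = Set.Ioo ((m : ℝ) / 10 ^ n - (c : ℝ) / 10 ^ n)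
      (((m : ℝ) + 1) / 10 ^ n + (c : ℝ) / 10 ^ n)}
  coding := iota

/-! ### Partial recursive functionals

Programs for unlimited register machines with `k` function oracles. -/

/-- The instructions of an unlimited register machine with `k` oracles. -/
inductive Instr (k : ℕ) : Type
  /-- Set register `r` to zero. -/
  | zero (r : ℕ)
  /-- Add one to register `r`. -/
  | succ (r : ℕ)
  /-- Copy the content of register `r` to register `s`. -/
  | copy (r s : ℕ)
  /-- Go to instruction number `q` if the registers `r` and `s` have the same content. -/
  | jump (r s q : ℕ)
  /-- Replace the content `l` of register `r` by the value of oracle number `i` at `l`. -/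
  | query (i : Fin k) (r : ℕ)

/-- Instructions as tuples of numbers; this provides their Gödel numbering. -/
def Instr.equivSum (k : ℕ) : Instr k ≃ ℕ ⊕ ℕ ⊕ (ℕ × ℕ) ⊕ (ℕ × ℕ × ℕ) ⊕ (Fin k × ℕ) where
  toFun
    | .zero r => .inl r
    | .succ r => .inr (.inl r)
    | .copy r s => .inr (.inr (.inl (r, s)))
    | .jump r s q => .inr (.inr (.inr (.inl (r, s, q))))
    | .query i r => .inr (.inr (.inr (.inr (i, r))))
  invFun
    | .inl r => .zero r
    | .inr (.inl r) => .succ r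
    | .inr (.inr (.inl (r, s))) => .copy r s
    | .inr (.inr (.inr (.inl (r, s, q)))) => .jump r s q
    | .inr (.inr (.inr (.inr (i, r)))) => .query i r
  left_inv x := by cases x <;> rfl
  right_inv x := by rcases x with _ | _ | ⟨_, _⟩ | ⟨_, _, _⟩ | ⟨_, _⟩ <;> rfl

instance (k : ℕ) : Primcodable (Instr k) := Primcodable.ofEquiv _ (Instr.equivSum k)

/-- An oracle program is a finite list of instructions, numbered from `0`. -/
abbrev OracleProgram (k : ℕ) : Type := List (Instr k)

/-- A configuration: the number of the next instruction and the contents of the registers. -/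
structure Config : Type where
  pc : ℕ
  reg : ℕ → ℕ

/-- The effect of one instruction, given the oracles `φ`. -/
def Instr.run {k : ℕ} (φ : Fin k → ℕ → ℕ) (C : Config) : Instr k → Config
  | .zero r => ⟨C.pc + 1, Function.update C.reg r 0⟩
  | .succ r => ⟨C.pc + 1, Function.update C.reg r (C.reg r + 1)⟩
  | .copy r s => ⟨C.pc + 1, Function.update C.reg s (C.reg r)⟩
  | .jump r s q => ⟨if C.reg r = C.reg s then q else C.pc + 1, C.reg⟩
  | .query i r => ⟨C.pc + 1, Function.update C.reg r (φ i (C.reg r))⟩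

/-- One step of a program; the program halts when there is no next instruction. -/
def OracleProgram.step {k : ℕ} (P : OracleProgram k) (φ : Fin k → ℕ → ℕ) (C : Config) :
    Option Config :=
  P[C.pc]?.map (Instr.run φ C)

/-- The value `κ(φ₁, …, φₖ, m)` of the partial recursive functional `κ` that is computed by `P`:
start at instruction `0` with `m` in register `0` and zero in all other registers, run until the
program halts, and read register `0`. -/
def OracleProgram.eval {k : ℕ} (P : OracleProgram k) (φ : Fin k → ℕ → ℕ) (m : ℕ) : Part ℕ :=
  (StateTransition.eval (P.step φ) ⟨0, Function.update (fun _ => 0) 0 m⟩).map fun C => C.reg 0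

/-! ### Physical models -/

/-- A physical model `(S, A)`: a set `S` of states and a set `A` of observable quantities. -/
structure PhysicalModel (α β : Type) where
  states : Set α
  observables : Set (α → β)

namespace PhysicalModel

/-- An isomorphism of physical models. -/
structure Iso {α β γ : Type} (M : PhysicalModel α γ) (N : PhysicalModel β γ) where
  onStates : M.states ≃ N.states
  onObservables : M.observables ≃ N.observables
  compat : ∀ (a : M.observables) (s : M.states), a.1 s.1 = (onObservables a).1 (onStates s).1

/-- Two physical models are isomorphic. -/
def Isomorphic {α β γ : Type} (M : PhysicalModel α γ) (N : PhysicalModel β γ) : Prop :=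
  Nonempty (Iso M N)

/-- A computable physical model: a recursive set of states, and total recursive functions as
observable quantities. -/
def IsComputable (M : PhysicalModel ℕ ℕ) : Prop :=
  ComputablePred (fun s => s ∈ M.states) ∧ ∀ a ∈ M.observables, Computable a

/-- A physical model in normal form: the states are points of `ℝⁿ` and the observable
quantities are the `n` coordinate projections. -/
def IsNormalForm {n : ℕ} (M : PhysicalModel (Fin n → ℝ) ℝ) : Prop :=
  M.observables = Set.range fun (i : Fin n) (x : Fin n → ℝ) => x i

/-- The model is induced by `ψ : ℝᵏ → ℝᵐ`: it is in normal form and its set of states is the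
graph of `ψ`, as a subset of `ℝᵏ⁺ᵐ`. -/
def IsInducedBy {k m : ℕ} (M : PhysicalModel (Fin (k + m) → ℝ) ℝ)
    (ψ : (Fin k → ℝ) → (Fin m → ℝ)) : Prop :=
  M.IsNormalForm ∧
    M.states = {z | ψ (fun i => z (Fin.castAdd m i)) = fun j => z (Fin.natAdd k j)}

/-- `N` is a basic representation of the model `M` in normal form, in the effective product of
the effective topologies `τ₁, …, τₙ` on the real line. -/
def IsBasicRepresentation {n : ℕ} (τ : Fin n → CodedBasis ℝ) (N : PhysicalModel ℕ ℕ)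
    (M : PhysicalModel (Fin n → ℝ) ℝ) : Prop :=
  M.IsNormalForm ∧ (∀ i, (τ i).IsEffectiveTopology) ∧
    (CodedBasis.product τ).IsBasicRepresentation N.states M.states ∧
    N.observables = Set.range fun i : Fin n => seqProj i

/-- The programs `P₁, …, Pₘ` compute functionals that witness Kreisel's criterion for the
model `M`. -/
def KreiselPrograms {k m : ℕ} (M : PhysicalModel (Fin (k + m) → ℝ) ℝ)
    (P : Fin m → OracleProgram k) : Prop :=
  ∃ ψ : (Fin k → ℝ) → (Fin m → ℝ), M.IsInducedBy ψ ∧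
    ∀ (x : Fin k → ℝ) (φ : Fin k → ℕ → ℕ),
      (∀ i, rationalIntervals.IsNestedOracle (φ i) (x i)) →
      ∀ j, ∃ κ : ℕ → ℕ, (∀ l, (P j).eval φ l = Part.some (κ l)) ∧
        rationalIntervals.IsNestedOracle κ (ψ x j)

/-- The model `M` satisfies Kreisel's criterion on `ℝᵏ`. -/
def SatisfiesKreisel {k m : ℕ} (M : PhysicalModel (Fin (k + m) → ℝ) ℝ) : Prop :=
  ∃ P : Fin m → OracleProgram k, M.KreiselPrograms P

end PhysicalModel

end CPM

/-!
A program halts after looking at finitely many values of its oracles, so a computation on nested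
intervals bounds `ψ` at every point that lies in all of them. Hence `ψ` is continuous, its graph is
closed, and the codes of the decimal boxes that meet the graph form a basic representation of it. A
box meets the graph exactly when some finite computation proves it, namely one in which the given
intervals have a point in common and both they and the resulting intervals lie in the sides of the
box; so these codes form a recursively enumerable set `R`. Such a set is the image of a decidable
one under an injection: replace each member of `R` by the pair of that member and the time at which
the enumerating program halts on it.
-/

open Encodable Set Filter Topology UniqueFactorizationMonoid

namespace CPM

section Computability

variable {α β : Type*} [Primcodable α] [Primcodable β]

theorem primrecPred_imp {p q : α → Prop} (hp : PrimrecPred p) (hq : PrimrecPred q) :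
    PrimrecPred fun a => p a → q a :=
  (hp.not.or hq).of_eq fun _ => imp_iff_not_or.symm

theorem primrecPred_forall_lt {f : α → ℕ} {p : α → ℕ → Prop} (hf : Primrec f)
    (hp : PrimrecRel p) : PrimrecPred fun a => ∀ x < f a, p a x :=
  ((PrimrecRel.forall_mem_list (R := fun x a => p a x) hp.swap).comp
    (Primrec.list_range.comp hf) Primrec.id).of_eq fun a => by simp

theorem primrecPred_const (p : Prop) : PrimrecPred fun _ : α => p := by
  classical exact ⟨inferInstance, Primrec.const (decide p)⟩

theorem primrecPred_forall_fin : ∀ {n : ℕ} {p : Fin n → α → Prop},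
    (∀ i, PrimrecPred (p i)) → PrimrecPred fun a => ∀ i, p i a
  | 0, _, _ => (primrecPred_const True).of_eq fun _ => by simp
  | _ + 1, _, h => ((h 0).and (primrecPred_forall_fin fun i => h i.succ)).of_eq fun _ => by
      rw [Fin.forall_fin_succ]

theorem primrec_apply {n : ℕ} {f : α → Fin n → β} (hf : Primrec f) (i : Fin n) :
    Primrec fun a => f a i :=
  Primrec.fin_app.comp hf (Primrec.const i)

theorem primrec_nat_pow : Primrec₂ ((· ^ ·) : ℕ → ℕ → ℕ) :=
  (Primrec.nat_rec (f := fun _ => 1) (g := fun x p => p.2 * x) (Primrec.const 1)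
    (Primrec.nat_mul.comp (Primrec.snd.comp Primrec.snd) Primrec.fst)).of_eq fun x n => by
    induction n with
    | zero => rfl
    | succ n ih => rw [pow_succ, ← ih]

theorem primrecRel_nat_dvd : PrimrecRel ((· ∣ ·) : ℕ → ℕ → Prop) :=
  (Primrec.eq.comp (Primrec.nat_mod.comp Primrec.snd Primrec.fst)
    (Primrec.const 0)).of_eq fun _ => (Nat.dvd_iff_mod_eq_zero).symm

theorem primrecRel_nat_coprime : PrimrecRel Nat.Coprime := by
  have h : PrimrecPred fun p : ℕ × ℕ => ∀ d < p.1 + p.2 + 1, d ∣ p.1 → d ∣ p.2 → d = 1 :=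
    primrecPred_forall_lt
      (Primrec.succ.comp (Primrec.nat_add.comp Primrec.fst Primrec.snd))
      (primrecPred_imp (primrecRel_nat_dvd.comp Primrec.snd (Primrec.fst.comp Primrec.fst))
        (primrecPred_imp (primrecRel_nat_dvd.comp Primrec.snd (Primrec.snd.comp Primrec.fst))
          (Primrec.eq.comp Primrec.snd (Primrec.const 1))))
  refine h.of_eq fun ⟨a, b⟩ => ⟨fun h => h (a.gcd b) ?_ (a.gcd_dvd_left b) (a.gcd_dvd_right b),
    fun h d _ => Nat.eq_one_of_dvd_coprimes h⟩
  rcases Nat.eq_zero_or_pos a with rfl | ha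
  · simp
  · have := Nat.gcd_le_left b ha
    omega

theorem primrecRel_exists_mem_decode {p : α → β → Prop} (hp : PrimrecRel p) :
    PrimrecRel fun a n => ∃ b ∈ decode (α := β) n, p a b := by
  classical
  have h : Primrec fun q : α × ℕ =>
      (decode (α := β) q.2).bind fun b => if p q.1 b then some b else none :=
    Primrec.option_bind (Primrec.decode.comp Primrec.snd)
      (Primrec.ite (hp.comp (Primrec.fst.comp Primrec.fst) Primrec.snd)
        (Primrec.option_some.comp Primrec.snd) (Primrec.const none))
  refine (Primrec.eq.comp (Primrec.option_isSome.comp h) (Primrec.const true)).of_eq fun q => ?_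
  simp [Option.isSome_iff_exists, Option.bind_eq_some_iff]

theorem primrec_of_graph {f : α → β} (bound : Primrec.PrimrecBounded f)
    (graph : PrimrecRel fun a b => f a = b) : Primrec f := by
  have h : PrimrecRel fun (q : α × ℕ) b => f q.1 = b ∧ encode b = q.2 :=
    (graph.comp (Primrec.fst.comp Primrec.fst) Primrec.snd).and
      (Primrec.eq.comp (Primrec.encode.comp Primrec.snd) (Primrec.snd.comp Primrec.fst))
  refine Primrec.encode_iff.1 (Primrec.of_graph bound
    (((primrecRel_exists_mem_decode h).comp Primrec.id Primrec.snd).of_eq fun q => ?_))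
  constructor
  · rintro ⟨b, -, rfl, hb⟩
    exact hb
  · rintro hq
    exact ⟨f q.1, by simp [← hq], rfl, hq⟩

theorem computablePred_comp {p : β → Prop} (hp : ComputablePred p) {f : α → β}
    (hf : Computable f) : ComputablePred fun a => p (f a) := by
  obtain ⟨_, hp⟩ := hp
  exact ⟨inferInstance, hp.comp hf⟩

theorem rePred_exists {p : α → β → Prop} (hp : PrimrecRel p) : REPred fun a => ∃ b, p a b := by
  classical
  have hq := (primrecRel_exists_mem_decode hp).decide.to_comp.partrec
  refine (Partrec.rfind hq.to₂).dom_re.of_eq fun a => ?_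
  refine Nat.rfind_dom.trans ⟨fun ⟨n, hn, _⟩ => ?_, fun ⟨b, hb⟩ => ⟨encode b, ?_, by simp⟩⟩
  · obtain ⟨b, -, hb⟩ := of_decide_eq_true (Part.mem_some_iff.1 hn).symm
    exact ⟨b, hb⟩
  · exact Part.mem_some_iff.2 (decide_eq_true (⟨b, by simp, hb⟩ : ∃ b' ∈ _, p a b')).symm

theorem exists_computable_code {f : α × ℕ →. ℕ} (hf : Partrec f) :
    ∃ r : α → Nat.Partrec.Code, Computable r ∧ ∀ a s, (r a).eval s = f (a, s) := by
  obtain ⟨c, hc⟩ := Nat.Partrec.Code.exists_code.1 hf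
  refine ⟨fun a => c.curry (encode a),
    (Nat.Partrec.Code.primrec₂_curry.comp (Primrec.const c) Primrec.encode).to_comp,
    fun a s => ?_⟩
  have h := congrFun hc (encode (a, s))
  simp only [encodek, Part.coe_some, Part.bind_some] at h
  rw [Nat.Partrec.Code.eval_curry]
  exact h.trans (by simp [Part.map_id'])

theorem exists_computable_code_dom {p : α × ℕ → Prop} (hp : REPred p) :
    ∃ r : α → Nat.Partrec.Code, Computable r ∧ ∀ a s, ((r a).eval s).Dom ↔ p (a, s) := by
  obtain ⟨r, hr, h⟩ := exists_computable_code (Partrec.map hp ((Computable.const 0).to₂))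
  refine ⟨r, hr, fun a s => ?_⟩
  simp [h, Part.assert]

theorem exists_computable_code_indicator {p : α × ℕ → Prop} (hp : ComputablePred p) :
    ∃ t : α → Nat.Partrec.Code, Computable t ∧ ∀ a s,
      (p (a, s) → (t a).eval s = Part.some 1) ∧ (¬p (a, s) → (t a).eval s = Part.some 0) := by
  obtain ⟨_, hp⟩ := hp
  obtain ⟨t, ht, h⟩ := exists_computable_code
    (Computable.cond hp (Computable.const 1) (Computable.const 0)).partrec
  exact ⟨t, ht, fun a s => ⟨fun hs => by simp [h, hs], fun hs => by simp [h, hs]⟩⟩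

end Computability

theorem cantorPair_surjective (s : ℕ) : ∃ x y, cantorPair x y = s := by
  induction s with
  | zero => exact ⟨0, 0, rfl⟩
  | succ s ih =>
    obtain ⟨x, y, h⟩ := ih
    have hs := two_mul_cantorPair x y
    cases y with
    | zero =>
      refine ⟨0, x + 1, ?_⟩
      have := two_mul_cantorPair 0 (x + 1)
      nlinarith
    | succ y =>
      refine ⟨x + 1, y, ?_⟩
      have := two_mul_cantorPair (x + 1) y
      nlinarith

/-- Cantor's pairing function as a bijection, whose inverse decodes pairs. -/
noncomputable def cantorEquiv : ℕ × ℕ ≃ ℕ :=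
  Equiv.ofBijective (fun p => cantorPair p.1 p.2)
    ⟨fun _ _ h => Prod.ext_iff.2 (cantorPair_injective h),
      fun s => let ⟨x, y, h⟩ := cantorPair_surjective s; ⟨(x, y), h⟩⟩

@[simp]
theorem cantorEquiv_apply (p : ℕ × ℕ) : cantorEquiv p = cantorPair p.1 p.2 := rfl

theorem add_le_cantorPair (x y : ℕ) : x + y ≤ cantorPair x y := by
  have := two_mul_cantorPair x y
  nlinarith

theorem primrec_cantorEquiv : Primrec cantorEquiv := by
  have h : Primrec fun p : ℕ × ℕ => (p.1 + p.2) * (p.1 + p.2 + 1) + 2 * p.1 :=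
    Primrec.nat_add.comp
      (Primrec.nat_mul.comp (Primrec.nat_add.comp Primrec.fst Primrec.snd)
        (Primrec.succ.comp (Primrec.nat_add.comp Primrec.fst Primrec.snd)))
      (Primrec.nat_double.comp Primrec.fst)
  refine (Primrec.nat_div2.comp h).of_eq fun p => ?_
  rw [← two_mul_cantorPair, Nat.div2_val, Nat.mul_div_cancel_left _ two_pos, cantorEquiv_apply]

theorem primrecBounded_natPair {α : Type*} [Primcodable α] {f : α → ℕ × ℕ} {B : α → ℕ}
    (hB : Primrec B) (h₁ : ∀ a, (f a).1 ≤ B a) (h₂ : ∀ a, (f a).2 ≤ B a) :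
    Primrec.PrimrecBounded f := by
  refine ⟨fun a => (B a + 1) * (B a + 1),
    Primrec.nat_mul.comp (Primrec.succ.comp hB) (Primrec.succ.comp hB), fun a => ?_⟩
  calc encode (f a) ≤ (max (f a).1 (f a).2 + 1) ^ 2 := (Nat.pair_lt_max_add_one_sq _ _).le
    _ ≤ (B a + 1) * (B a + 1) := by
      rw [sq]
      gcongr <;> exact max_le (h₁ a) (h₂ a)

theorem primrec_cantorEquiv_symm : Primrec cantorEquiv.symm := by
  have hle (s : ℕ) : (cantorEquiv.symm s).1 + (cantorEquiv.symm s).2 ≤ s := by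
    simpa only [← cantorEquiv_apply, Equiv.apply_symm_apply] using
      add_le_cantorPair (cantorEquiv.symm s).1 (cantorEquiv.symm s).2
  refine primrec_of_graph (primrecBounded_natPair Primrec.id
    (fun s => (Nat.le_add_right _ _).trans (hle s)) fun s => (Nat.le_add_left _ _).trans (hle s)) ?_
  exact (Primrec.eq.comp Primrec.fst (primrec_cantorEquiv.comp Primrec.snd)).of_eq fun p =>
    cantorEquiv.symm_apply_eq.symm

theorem seqCode_surjective : ∀ n : ℕ, Function.Surjective (seqCode (n := n + 1))
  | 0, s => ⟨fun _ => s, rfl⟩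
  | n + 1, s => by
    obtain ⟨x, hx⟩ := seqCode_surjective n (cantorEquiv.symm s).1
    refine ⟨Fin.snoc x (cantorEquiv.symm s).2, ?_⟩
    rw [seqCode, Fin.init_snoc, hx, Fin.snoc_last, ← cantorEquiv_apply, Equiv.apply_symm_apply]

theorem seqProj_last {n : ℕ} (s : ℕ) :
    seqProj (Fin.last (n + 1)) s = (cantorEquiv.symm s).2 := by
  obtain ⟨x, rfl⟩ := seqCode_surjective (n + 1) s
  rw [seqProj_seqCode, seqCode, ← cantorEquiv_apply (_, _), Equiv.symm_apply_apply]

theorem seqProj_castSucc {n : ℕ} (i : Fin (n + 1)) (s : ℕ) :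
    seqProj i.castSucc s = seqProj i (cantorEquiv.symm s).1 := by
  obtain ⟨x, rfl⟩ := seqCode_surjective (n + 1) s
  rw [seqProj_seqCode, seqCode, ← cantorEquiv_apply (_, _), Equiv.symm_apply_apply,
    seqProj_seqCode]
  rfl

theorem primrec_seqProj : ∀ {n : ℕ} (i : Fin n), Primrec (seqProj i)
  | 1, i => Primrec.id.of_eq fun s => by
    obtain ⟨x, rfl⟩ := seqCode_surjective 0 s
    rw [seqProj_seqCode, Subsingleton.elim i 0, id, seqCode]
  | n + 2, i => by
    induction i using Fin.lastCases with
    | last => exact (Primrec.snd.comp primrec_cantorEquiv_symm).of_eq fun s => (seqProj_last s).symm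
    | cast i =>
      exact ((primrec_seqProj i).comp (Primrec.fst.comp primrec_cantorEquiv_symm)).of_eq fun s =>
        (seqProj_castSucc i s).symm

/-- The coding `ζ` of the integers as a bijection. -/
def zetaEquiv : ℤ ≃ ℕ where
  toFun := zeta
  invFun n := if n % 2 = 0 then n / 2 else -((n + 1) / 2)
  left_inv i := by
    dsimp only [zeta]
    grind
  right_inv n := by
    dsimp only [zeta]
    grind

@[simp]
theorem zetaEquiv_apply (i : ℤ) : zetaEquiv i = zeta i := rfl

theorem natAbs_eq_zeta_succ_div_two (i : ℤ) : i.natAbs = (zeta i + 1) / 2 := by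
  unfold zeta
  split <;> omega

/-- The product `∏ₚ p ^ ζ(vₚ(q))` over the primes dividing the numerator or the denominator. -/
def rhoAbs (q : ℚ) : ℕ :=
  ∏ p ∈ (q.num.natAbs * q.den).primeFactors, p ^ zeta (padicValRat p q)

/-- The integer whose `ζ`-code is `ρ(q)`. -/
def rhoInt (q : ℚ) : ℤ := q.num.sign * rhoAbs q

theorem rho_eq_zeta_rhoInt (q : ℚ) : rho q = zeta (rhoInt q) := by
  simp [rho, rhoInt, rhoAbs]

theorem rhoAbs_ne_zero (q : ℚ) : rhoAbs q ≠ 0 :=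
  Finset.prod_ne_zero_iff.2 fun _ hp => pow_ne_zero _ (Nat.prime_of_mem_primeFactors hp).ne_zero

theorem rhoInt_neg (q : ℚ) : rhoInt (-q) = -rhoInt q := by
  simp [rhoInt, rhoAbs, padicValRat.neg, Int.sign_neg]

theorem natAbs_rhoInt {q : ℚ} (hq : q ≠ 0) : (rhoInt q).natAbs = rhoAbs q := by
  simp [rhoInt, Int.natAbs_mul, Int.natAbs_sign_of_ne_zero (Rat.num_ne_zero.2 hq)]

theorem rhoInt_pos_iff {q : ℚ} : 0 < rhoInt q ↔ 0 < q := by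
  rw [rhoInt, mul_pos_iff_of_pos_right (by exact_mod_cast (rhoAbs_ne_zero q).bot_lt),
    Int.sign_pos_iff, Rat.num_pos]

theorem rhoInt_neg_iff {q : ℚ} : rhoInt q < 0 ↔ q < 0 := by
  rw [← neg_pos, ← rhoInt_neg, rhoInt_pos_iff, neg_pos]

theorem factorization_num_den (q : ℚ) {p : ℕ} (hp : p.Prime) :
    q.num.natAbs.factorization p = (padicValRat p q).toNat ∧
      q.den.factorization p = (-padicValRat p q).toNat := by
  have hv := padicValRat_def p q
  rw [padicValInt, ← Nat.factorization_def _ hp, ← Nat.factorization_def _ hp] at hv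
  have hzero : q.num.natAbs.factorization p = 0 ∨ q.den.factorization p = 0 := by
    by_contra! h
    exact hp.one_lt.ne' (Nat.eq_one_of_dvd_coprimes q.reduced
      (Nat.dvd_of_factorization_pos h.1) (Nat.dvd_of_factorization_pos h.2))
  omega

theorem factorization_rhoAbs {q : ℚ} (hq : q ≠ 0) {p : ℕ} (hp : p.Prime) :
    (rhoAbs q).factorization p = zeta (padicValRat p q) := by
  have hsum : (rhoAbs q).factorization =
      ∑ p ∈ (q.num.natAbs * q.den).primeFactors, Finsupp.single p (zeta (padicValRat p q)) := by
    rw [rhoAbs, Nat.factorization_prod fun p hp =>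
      pow_ne_zero _ (Nat.prime_of_mem_primeFactors hp).ne_zero]
    exact Finset.sum_congr rfl fun p hp => (Nat.prime_of_mem_primeFactors hp).factorization_pow
  rw [hsum, Finset.sum_apply']
  simp only [Finsupp.single_apply, Finset.sum_ite_eq']
  split_ifs with hdvd
  · rfl
  have hv : padicValRat p q = 0 := by
    have hfac : (q.num.natAbs * q.den).factorization p = 0 := Finsupp.notMem_support_iff.1 hdvd
    rw [Nat.factorization_mul (by simpa using hq) q.den_ne_zero, Finsupp.add_apply,
      (factorization_num_den q hp).1, (factorization_num_den q hp).2] at hfac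
    omega
  rw [hv, zeta, if_neg (lt_irrefl 0), mul_zero, Int.toNat_zero]

theorem factorization_radical {n p : ℕ} (hp : p.Prime) :
    (radical n).factorization p = min 1 (n.factorization p) := by
  rcases eq_or_ne n 0 with rfl | hn
  · simp
  by_cases hdvd : p ∣ n
  · rw [min_eq_left (hp.factorization_pos_of_dvd hn hdvd)]
    refine le_antisymm (squarefree_radical.natFactorization_le_one p) ?_
    exact hp.factorization_pos_of_dvd radical_ne_zero
      ((dvd_radical_iff_of_irreducible hp hn).2 hdvd)
  · rw [Nat.factorization_eq_zero_of_not_dvd hdvd, Nat.factorization_eq_zero_of_not_dvd fun h =>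
      hdvd (h.trans radical_dvd_self), min_eq_right zero_le_one]

/-- The exponent `ζ(v)` is `2v` for `v ≥ 0` and `-2v - 1` for `v < 0`, so each prime of the
denominator falls one short of its exponent in the square: multiplying by the radical makes `ρ`
decidable without factoring. -/
theorem rhoAbs_mul_radical_den {q : ℚ} (hq : q ≠ 0) :
    rhoAbs q * radical q.den = q.num.natAbs ^ 2 * q.den ^ 2 := by
  have hn : q.num.natAbs ≠ 0 := by simpa using hq
  refine Nat.eq_of_factorization_eq (mul_ne_zero (rhoAbs_ne_zero q) radical_ne_zero)
    (by simp [hq]) fun p => ?_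
  by_cases hp : p.Prime
  · rw [Nat.factorization_mul (rhoAbs_ne_zero q) radical_ne_zero,
      Nat.factorization_mul (pow_ne_zero 2 hn) (pow_ne_zero 2 q.den_ne_zero)]
    simp only [Finsupp.add_apply, Nat.factorization_pow, Finsupp.smul_apply, smul_eq_mul,
      factorization_radical hp, factorization_rhoAbs hq hp, (factorization_num_den q hp).1,
      (factorization_num_den q hp).2, zeta]
    split_ifs <;> omega
  · simp only [Nat.factorization_eq_zero_of_not_prime _ hp]

theorem eq_of_rhoAbs_eq {q r : ℚ} (hq : 0 < q) (hr : 0 < r) (h : rhoAbs q = rhoAbs r) : q = r := by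
  have hv {p : ℕ} (hp : p.Prime) : padicValRat p q = padicValRat p r :=
    zetaEquiv.injective (by
      rw [zetaEquiv_apply, zetaEquiv_apply, ← factorization_rhoAbs hq.ne' hp, h,
        factorization_rhoAbs hr.ne' hp])
  have hnum : q.num.natAbs = r.num.natAbs := by
    refine Nat.eq_of_factorization_eq (by simpa using hq.ne') (by simpa using hr.ne') fun p => ?_
    by_cases hp : p.Prime
    · rw [(factorization_num_den q hp).1, (factorization_num_den r hp).1, hv hp]
    · simp only [Nat.factorization_eq_zero_of_not_prime _ hp]
  have hden : q.den = r.den := by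
    refine Nat.eq_of_factorization_eq q.den_ne_zero r.den_ne_zero fun p => ?_
    by_cases hp : p.Prime
    · rw [(factorization_num_den q hp).2, (factorization_num_den r hp).2, hv hp]
    · simp only [Nat.factorization_eq_zero_of_not_prime _ hp]
  have := Rat.num_pos.2 hq
  have := Rat.num_pos.2 hr
  exact Rat.ext (by omega) hden

theorem exists_pos_rhoAbs_eq {n : ℕ} (hn : n ≠ 0) : ∃ q : ℚ, 0 < q ∧ rhoAbs q = n := by
  have exists_factorization (f : ℕ → ℕ) (hf : f 0 = 0) :
      ∃ a, 0 < a ∧ ∀ p, a.factorization p = f (n.factorization p) := by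
    have hprime : ∀ p ∈ (n.factorization.mapRange f hf).support, p.Prime := fun p hp =>
      Nat.prime_of_mem_primeFactors (Finsupp.support_mapRange hp)
    refine ⟨(n.factorization.mapRange f hf).prod (· ^ ·),
      Finset.prod_pos fun p hp => pow_pos (hprime p hp).pos _, fun p => ?_⟩
    rw [Nat.prod_pow_factorization_eq_self hprime, Finsupp.mapRange_apply]
  obtain ⟨a, ha, hav⟩ := exists_factorization (fun e => (zetaEquiv.symm e).toNat) rfl
  obtain ⟨b, hb, hbv⟩ := exists_factorization (fun e => (-zetaEquiv.symm e).toNat) rfl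
  have hpos : (0 : ℚ) < a / b := by positivity
  refine ⟨a / b, hpos, Nat.eq_of_factorization_eq (rhoAbs_ne_zero _) hn fun p => ?_⟩
  by_cases hp : p.Prime
  · have : Fact p.Prime := ⟨hp⟩
    have hv : padicValRat p (a / b) = zetaEquiv.symm (n.factorization p) := by
      rw [padicValRat.div (by positivity) (by positivity), padicValRat.of_nat, padicValRat.of_nat,
        ← Nat.factorization_def _ hp, ← Nat.factorization_def _ hp, hav, hbv]
      omega
    rw [factorization_rhoAbs hpos.ne' hp, hv, ← zetaEquiv_apply, Equiv.apply_symm_apply]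
  · simp only [Nat.factorization_eq_zero_of_not_prime _ hp]

theorem rhoInt_bijective : Function.Bijective rhoInt := by
  have hpos {q : ℚ} (hq : 0 < q) : rhoInt q = rhoAbs q := by
    rw [← natAbs_rhoInt hq.ne', Int.natAbs_of_nonneg (rhoInt_pos_iff.2 hq).le]
  have hzero : rhoInt 0 = 0 := by simp [rhoInt]
  constructor
  · have key {q r : ℚ} (hq : 0 < q) (h : rhoInt q = rhoInt r) : q = r := by
      have hr := rhoInt_pos_iff.1 (h ▸ rhoInt_pos_iff.2 hq)
      rw [hpos hq, hpos hr, Nat.cast_inj] at h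
      exact eq_of_rhoAbs_eq hq hr h
    intro q r h
    rcases lt_trichotomy q 0 with hq | rfl | hq
    · exact neg_injective (key (neg_pos.2 hq) (by rw [rhoInt_neg, rhoInt_neg, h]))
    · have hr : rhoInt r = 0 := by rw [← h, hzero]
      exact le_antisymm (not_lt.1 fun hlt => (rhoInt_neg_iff.2 hlt).ne hr)
        (not_lt.1 fun hlt => (rhoInt_pos_iff.2 hlt).ne' hr)
    · exact key hq h
  · intro i
    rcases lt_trichotomy i 0 with hi | rfl | hi
    · obtain ⟨q, hq, h⟩ := exists_pos_rhoAbs_eq (Int.natAbs_ne_zero.2 hi.ne)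
      exact ⟨-q, by rw [rhoInt_neg, hpos hq, h]; omega⟩
    · exact ⟨0, hzero⟩
    · obtain ⟨q, hq, h⟩ := exists_pos_rhoAbs_eq (Int.natAbs_ne_zero.2 hi.ne')
      exact ⟨q, by rw [hpos hq, h]; omega⟩

/-- The coding `ρ` of the rational numbers as a bijection, whose inverse decodes. -/
noncomputable def rhoEquiv : ℚ ≃ ℕ :=
  Equiv.ofBijective rho <| by
    rw [show rho = zetaEquiv ∘ rhoInt from funext rho_eq_zeta_rhoInt]
    exact zetaEquiv.bijective.comp rhoInt_bijective

@[simp]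
theorem rhoEquiv_apply (q : ℚ) : rhoEquiv q = rho q := rfl

theorem rho_mul_radical_den (q : ℚ) :
    (rho q + 1) / 2 * radical q.den = q.num.natAbs ^ 2 * q.den ^ 2 := by
  rw [rho_eq_zeta_rhoInt, ← natAbs_eq_zeta_succ_div_two]
  rcases eq_or_ne q 0 with rfl | hq
  · simp [rhoInt]
  · rw [natAbs_rhoInt hq, rhoAbs_mul_radical_den hq]

theorem num_den_eq_of_mul_radical_eq {q : ℚ} {a b : ℕ} (hab : a.Coprime b) (hb : 0 < b)
    (h : (rho q + 1) / 2 * radical b = a ^ 2 * b ^ 2) : (q.num.natAbs, q.den) = (a, b) := by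
  obtain ⟨r, hrn, hrd⟩ : ∃ r : ℚ, r.num = a ∧ r.den = b :=
    ⟨⟨a, b, hb.ne', by simpa using hab⟩, rfl, rfl⟩
  have hr := rho_mul_radical_den r
  rw [hrn, hrd, Int.natAbs_natCast, ← h] at hr
  replace hr := Nat.eq_of_mul_eq_mul_right (Nat.radical_pos b) hr
  rw [rho_eq_zeta_rhoInt, rho_eq_zeta_rhoInt, ← natAbs_eq_zeta_succ_div_two,
    ← natAbs_eq_zeta_succ_div_two, Int.natAbs_eq_natAbs_iff, ← rhoInt_neg] at hr
  rcases hr with hr | hr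
  · rw [← rhoInt_bijective.injective hr, hrn, hrd, Int.natAbs_natCast]
  · rw [← neg_eq_iff_eq_neg.2 (rhoInt_bijective.injective hr), Rat.num_neg_eq_neg_num,
      Rat.den_neg_eq_den, hrn, hrd, Int.natAbs_neg, Int.natAbs_natCast]

theorem num_den_le (q : ℚ) : q.num.natAbs ≤ rho q + 1 ∧ q.den ≤ rho q + 1 := by
  rcases eq_or_ne q 0 with rfl | hq
  · simp
  have hn : 0 < q.num.natAbs := Int.natAbs_pos.2 (Rat.num_ne_zero.2 hq)
  have hmul : q.num.natAbs ^ 2 * q.den ≤ (rho q + 1) / 2 := by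
    refine Nat.le_of_mul_le_mul_right ?_ q.den_pos
    calc q.num.natAbs ^ 2 * q.den * q.den = (rho q + 1) / 2 * radical q.den := by
          rw [rho_mul_radical_den, sq q.den, mul_assoc]
      _ ≤ (rho q + 1) / 2 * q.den := by
          gcongr
          exact Nat.radical_le_self_iff.2 q.den_ne_zero
  have hhalf : q.num.natAbs ^ 2 * q.den ≤ rho q + 1 := hmul.trans (Nat.div_le_self _ 2)
  exact ⟨(Nat.le_self_pow two_ne_zero _).trans ((Nat.le_mul_of_pos_right _ q.den_pos).trans hhalf),
    (Nat.le_mul_of_pos_left _ (pow_pos hn 2)).trans hhalf⟩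

theorem radical_eq_iff {b r : ℕ} (hb : b ≠ 0) :
    radical b = r ↔ (0 < r ∧ b ∣ r ^ b) ∧ ∀ x < r, 0 < x → ¬ b ∣ x ^ b := by
  have hle {x : ℕ} (hx : 0 < x) (hdvd : b ∣ x ^ b) : radical b ≤ x :=
    Nat.le_of_dvd hx ((exists_dvd_pow_iff_radical_dvd hb).1 ⟨b, hdvd⟩)
  constructor
  · rintro rfl
    exact ⟨⟨Nat.radical_pos b, Nat.dvd_radical_pow_self hb⟩,
      fun x hx hx0 hdvd => hx.not_ge (hle hx0 hdvd)⟩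
  · rintro ⟨⟨hr, hdvd⟩, hmin⟩
    refine (hle hr hdvd).eq_of_not_lt fun hlt => ?_
    exact hmin _ hlt (Nat.radical_pos b) (Nat.dvd_radical_pow_self hb)

theorem primrec_radical_succ : Primrec fun b : ℕ => radical (b + 1) := by
  refine Primrec.of_graph ⟨Nat.succ, Primrec.succ, fun b =>
    Nat.radical_le_self_iff.2 b.succ_ne_zero⟩ ?_
  have hdvd : PrimrecRel fun b x : ℕ => b + 1 ∣ x ^ (b + 1) :=
    primrecRel_nat_dvd.comp (Primrec.succ.comp Primrec.fst)
      (primrec_nat_pow.comp Primrec.snd (Primrec.succ.comp Primrec.fst))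
  have hmin : PrimrecPred fun p : ℕ × ℕ => ∀ x < p.2, 0 < x → ¬ p.1 + 1 ∣ x ^ (p.1 + 1) :=
    primrecPred_forall_lt Primrec.snd
      (primrecPred_imp (Primrec.nat_lt.comp (Primrec.const 0) Primrec.snd)
        (hdvd.comp (Primrec.fst.comp Primrec.fst) Primrec.snd).not)
  exact (((Primrec.nat_lt.comp (Primrec.const 0) Primrec.snd).and hdvd).and hmin).of_eq fun p =>
    (radical_eq_iff p.1.succ_ne_zero).symm

theorem primrec_natAbs_num_den :
    Primrec fun s => ((rhoEquiv.symm s).num.natAbs, (rhoEquiv.symm s).den) := by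
  have hgraph : PrimrecRel fun (s : ℕ) (p : ℕ × ℕ) =>
      (p.1.Coprime p.2 ∧ 0 < p.2) ∧
        (s + 1) / 2 * radical (p.2 - 1 + 1) = p.1 * p.1 * (p.2 * p.2) := by
    have hM : Primrec fun s : ℕ => (s + 1) / 2 :=
      (Primrec.nat_div2.comp Primrec.succ).of_eq fun s => Nat.div2_val _
    have ha : Primrec fun p : ℕ × ℕ × ℕ => p.2.1 := Primrec.fst.comp Primrec.snd
    have hb : Primrec fun p : ℕ × ℕ × ℕ => p.2.2 := Primrec.snd.comp Primrec.snd
    exact ((primrecRel_nat_coprime.comp ha hb).and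
      (Primrec.nat_lt.comp (Primrec.const 0) hb)).and <| Primrec.eq.comp
        (Primrec.nat_mul.comp (hM.comp Primrec.fst)
          (primrec_radical_succ.comp (Primrec.pred.comp hb)))
        (Primrec.nat_mul.comp (Primrec.nat_mul.comp ha ha) (Primrec.nat_mul.comp hb hb))
  refine primrec_of_graph (primrecBounded_natPair Primrec.succ
    (fun s => ?_) fun s => ?_) (hgraph.of_eq fun s p => ?_)
  · simpa [← rhoEquiv_apply] using (num_den_le (rhoEquiv.symm s)).1
  · simpa [← rhoEquiv_apply] using (num_den_le (rhoEquiv.symm s)).2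
  · obtain ⟨q, rfl⟩ := rhoEquiv.surjective s
    rw [Equiv.symm_apply_apply, rhoEquiv_apply, ← sq, ← sq]
    constructor
    · rintro ⟨⟨hab, hb⟩, h⟩
      rw [Nat.sub_add_cancel hb] at h
      exact num_den_eq_of_mul_radical_eq hab hb h
    · rintro rfl
      exact ⟨⟨q.reduced, q.den_pos⟩, by rw [Nat.sub_add_cancel q.den_pos, rho_mul_radical_den]⟩

theorem rho_mod_two_eq_one_iff {q : ℚ} : rho q % 2 = 1 ↔ q < 0 := by
  rw [rho_eq_zeta_rhoInt, ← rhoInt_neg_iff, zeta]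
  split <;> omega

/-- A primitive recursive function to the rational numbers: numerator, as a difference of natural
numbers, and denominator are computed separately. -/
def PrimrecRat {α : Type*} [Primcodable α] (f : α → ℚ) : Prop :=
  ∃ x y b : α → ℕ, Primrec x ∧ Primrec y ∧ Primrec b ∧
    ∀ a, 0 < b a ∧ f a = ((x a : ℚ) - y a) / b a

namespace PrimrecRat

variable {α β : Type*} [Primcodable α] [Primcodable β]

theorem comp {f : β → ℚ} (hf : PrimrecRat f) {g : α → β} (hg : Primrec g) :
    PrimrecRat fun a => f (g a) := by
  obtain ⟨x, y, b, hx, hy, hb, h⟩ := hf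
  exact ⟨_, _, _, hx.comp hg, hy.comp hg, hb.comp hg, fun a => h (g a)⟩

theorem le {f g : α → ℚ} (hf : PrimrecRat f) (hg : PrimrecRat g) :
    PrimrecPred fun a => f a ≤ g a := by
  obtain ⟨x, y, b, hx, hy, hb, h⟩ := hf
  obtain ⟨u, v, d, hu, hv, hd, h'⟩ := hg
  have hcross : PrimrecPred fun a => x a * d a + v a * b a ≤ u a * b a + y a * d a :=
    Primrec.nat_le.comp
      (Primrec.nat_add.comp (Primrec.nat_mul.comp hx hd) (Primrec.nat_mul.comp hv hb))
      (Primrec.nat_add.comp (Primrec.nat_mul.comp hu hb) (Primrec.nat_mul.comp hy hd))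
  refine hcross.of_eq fun a => ?_
  rw [(h a).2, (h' a).2, div_le_div_iff₀ (Nat.cast_pos.2 (h a).1) (Nat.cast_pos.2 (h' a).1),
    ← Nat.cast_le (α := ℚ)]
  push_cast
  constructor <;> intro h <;> linarith

theorem lt {f g : α → ℚ} (hf : PrimrecRat f) (hg : PrimrecRat g) :
    PrimrecPred fun a => f a < g a :=
  (hg.le hf).not.of_eq fun _ => not_le

theorem eq {f g : α → ℚ} (hf : PrimrecRat f) (hg : PrimrecRat g) :
    PrimrecPred fun a => f a = g a :=
  ((hf.le hg).and (hg.le hf)).of_eq fun _ => le_antisymm_iff.symm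

end PrimrecRat

theorem primrecRat_rhoEquiv_symm : PrimrecRat rhoEquiv.symm := by
  have hn := Primrec.fst.comp primrec_natAbs_num_den
  have hodd : PrimrecPred fun s : ℕ => s % 2 = 1 :=
    Primrec.eq.comp (Primrec.nat_mod.comp Primrec.id (Primrec.const 2)) (Primrec.const 1)
  refine ⟨_, _, _, Primrec.ite hodd (Primrec.const 0) hn, Primrec.ite hodd hn (Primrec.const 0),
    Primrec.snd.comp primrec_natAbs_num_den, fun s => ⟨(rhoEquiv.symm s).den_pos, ?_⟩⟩
  obtain ⟨q, rfl⟩ := rhoEquiv.surjective s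
  rw [Equiv.symm_apply_apply]
  simp only [rhoEquiv_apply, rho_mod_two_eq_one_iff, ← Rat.num_neg]
  conv_lhs => rw [← Rat.num_div_den q]
  congr 1
  split_ifs with hneg
  · rw [Nat.cast_zero, zero_sub, Nat.cast_natAbs, abs_of_neg hneg, Int.cast_neg, neg_neg]
  · rw [Nat.cast_zero, sub_zero, Nat.cast_natAbs, abs_of_nonneg (not_lt.1 hneg)]

/-- The left end point of the interval with code `s`. -/
noncomputable def lower (s : ℕ) : ℚ := rhoEquiv.symm (cantorEquiv.symm s).1

/-- The right end point of the interval with code `s`. -/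
noncomputable def upper (s : ℕ) : ℚ := rhoEquiv.symm (cantorEquiv.symm s).2

@[simp]
theorem lower_ratPair (a b : ℚ) : lower (ratPair a b) = a := by
  rw [lower, ratPair, ← cantorEquiv_apply (_, _), Equiv.symm_apply_apply, ← rhoEquiv_apply,
    Equiv.symm_apply_apply]

@[simp]
theorem upper_ratPair (a b : ℚ) : upper (ratPair a b) = b := by
  rw [upper, ratPair, ← cantorEquiv_apply (_, _), Equiv.symm_apply_apply, ← rhoEquiv_apply b,
    Equiv.symm_apply_apply]

@[simp]
theorem ratPair_lower_upper (s : ℕ) : ratPair (lower s) (upper s) = s := by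
  rw [ratPair, ← rhoEquiv_apply, ← rhoEquiv_apply, lower, upper, Equiv.apply_symm_apply,
    Equiv.apply_symm_apply, ← cantorEquiv_apply, Equiv.apply_symm_apply]

theorem iota_eq_Ioo (s : ℕ) : iota s = Ioo (lower s : ℝ) (upper s) := by
  refine Set.ext fun x => ⟨?_, fun h => ⟨lower s, upper s, (ratPair_lower_upper s).symm, h⟩⟩
  rintro ⟨a, b, rfl, ha, hb⟩
  rw [lower_ratPair, upper_ratPair]
  exact ⟨ha, hb⟩

theorem iota_ratPair (a b : ℚ) : iota (ratPair a b) = Ioo (a : ℝ) b := by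
  rw [iota_eq_Ioo, lower_ratPair, upper_ratPair]

theorem iota_eq_Ioo_iff {s : ℕ} {a b : ℚ} (hab : a < b) :
    iota s = Ioo (a : ℝ) b ↔ lower s = a ∧ upper s = b := by
  constructor
  · intro h
    have hs : (lower s : ℝ) < upper s := by
      rw [← nonempty_Ioo, ← iota_eq_Ioo, h, nonempty_Ioo]
      exact Rat.cast_lt.2 hab
    rw [iota_eq_Ioo] at h
    have h₁ := (Ioo_subset_Ioo_iff hs).1 h.subset
    have h₂ := (Ioo_subset_Ioo_iff (Rat.cast_lt.2 hab)).1 h.superset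
    exact ⟨Rat.cast_injective (h₂.1.antisymm h₁.1), Rat.cast_injective (h₁.2.antisymm h₂.2)⟩
  · rintro ⟨rfl, rfl⟩
    exact iota_eq_Ioo s

theorem isOpen_iota (s : ℕ) : IsOpen (iota s) := by
  rw [iota_eq_Ioo]
  exact isOpen_Ioo

theorem iota_nonempty_iff {s : ℕ} : (iota s).Nonempty ↔ lower s < upper s := by
  rw [iota_eq_Ioo, nonempty_Ioo, Rat.cast_lt]

theorem iota_subset_iota_iff {s t : ℕ} :
    iota s ⊆ iota t ↔ (lower s < upper s → lower t ≤ lower s ∧ upper s ≤ upper t) := by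
  by_cases h : lower s < upper s
  · rw [iota_eq_Ioo, iota_eq_Ioo, Ioo_subset_Ioo_iff (Rat.cast_lt.2 h), Rat.cast_le, Rat.cast_le,
      imp_iff_right h]
  · rw [← iota_nonempty_iff, not_nonempty_iff_eq_empty] at h
    simp [h, ← iota_nonempty_iff]

theorem primrecRat_lower : PrimrecRat lower :=
  primrecRat_rhoEquiv_symm.comp (Primrec.fst.comp primrec_cantorEquiv_symm)

theorem primrecRat_upper : PrimrecRat upper :=
  primrecRat_rhoEquiv_symm.comp (Primrec.snd.comp primrec_cantorEquiv_symm)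

theorem primrecPred_iota_nonempty : PrimrecPred fun s => (iota s).Nonempty :=
  (primrecRat_lower.lt primrecRat_upper).of_eq fun _ => iota_nonempty_iff.symm

theorem primrecRel_iota_subset : PrimrecRel fun s t => iota s ⊆ iota t :=
  (primrecPred_imp
    ((primrecRat_lower.comp Primrec.fst).lt (primrecRat_upper.comp Primrec.fst))
    (((primrecRat_lower.comp Primrec.snd).le (primrecRat_lower.comp Primrec.fst)).and
      ((primrecRat_upper.comp Primrec.fst).le (primrecRat_upper.comp Primrec.snd)))).of_eq
    fun _ => iota_subset_iota_iff.symm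

theorem mem_rationalIntervals_dom_iff {s : ℕ} :
    s ∈ rationalIntervals.dom ↔ (iota s).Nonempty := by
  constructor
  · rintro ⟨a, b, hab, h⟩
    rw [show iota s = _ from h, nonempty_Ioo]
    exact_mod_cast hab
  · exact fun h => ⟨lower s, upper s, iota_nonempty_iff.1 h, iota_eq_Ioo s⟩

theorem nhds_hasBasis_iota (x : ℝ) : (𝓝 x).HasBasis (x ∈ iota ·) iota := by
  refine Real.isTopologicalBasis_Ioo_rat.nhds_hasBasis.to_hasBasis (fun V hV => ?_)
    fun s hs => ⟨iota s, ⟨?_, hs⟩, subset_rfl⟩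
  · obtain ⟨hV, hx⟩ := hV
    simp only [mem_iUnion, mem_singleton_iff] at hV
    obtain ⟨a, b, -, rfl⟩ := hV
    exact ⟨ratPair a b, by rwa [iota_ratPair], by rw [iota_ratPair]⟩
  · simp only [mem_iUnion, mem_singleton_iff]
    exact ⟨lower s, upper s, iota_nonempty_iff.1 ⟨x, hs⟩, iota_eq_Ioo s⟩

theorem isNestedOracle_iff_hasAntitoneBasis {φ : ℕ → ℕ} {x : ℝ} :
    rationalIntervals.IsNestedOracle φ x ↔ (𝓝 x).HasAntitoneBasis fun n => iota (φ n) := by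
  constructor
  · rintro ⟨⟨-, -, hmem, hbasis⟩, hnested⟩
    refine ⟨(nhds_hasBasis_iota x).to_hasBasis (fun s hs => ?_)
      (fun n _ => ⟨φ n, hmem _ ⟨_, ⟨n, rfl⟩, rfl⟩, subset_rfl⟩), antitone_nat_of_succ_le hnested⟩
    obtain ⟨_, ⟨_, ⟨n, rfl⟩, rfl⟩, hn⟩ :=
      hbasis _ (mem_rationalIntervals_dom_iff.2 ⟨x, hs⟩) hs
    exact ⟨n, trivial, hn⟩
  · intro h
    have hmem (n : ℕ) : x ∈ iota (φ n) := mem_of_mem_nhds (h.mem n)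
    have hdom (n : ℕ) : φ n ∈ rationalIntervals.dom := mem_rationalIntervals_dom_iff.2 ⟨x, hmem n⟩
    refine ⟨⟨hdom, ?_, ?_, ?_⟩, fun n => h.antitone n.le_succ⟩
    · rintro _ ⟨_, ⟨n, rfl⟩, rfl⟩
      exact hdom n
    · rintro _ ⟨_, ⟨n, rfl⟩, rfl⟩
      exact hmem n
    · rintro _ ⟨a, b, -, rfl⟩ hx
      obtain ⟨n, hn⟩ := h.mem_iff.1 (isOpen_Ioo.mem_nhds hx)
      exact ⟨_, ⟨_, ⟨n, rfl⟩, rfl⟩, hn⟩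

theorem exists_hasAntitoneBasis_iota (x : ℝ) :
    ∃ φ : ℕ → ℕ, (𝓝 x).HasAntitoneBasis fun n => iota (φ n) :=
  let ⟨φ, _, h⟩ := (nhds_hasBasis_iota x).exists_antitone_subbasis
  ⟨φ, h⟩

theorem exists_hasAntitoneBasis_iota_extending {x : ℝ} {f : ℕ → ℕ} {N : ℕ}
    (hf : AntitoneOn (fun n => iota (f n)) (Iic N)) (hx : x ∈ iota (f N)) :
    ∃ φ : ℕ → ℕ, (𝓝 x).HasAntitoneBasis (fun n => iota (φ n)) ∧ ∀ n ≤ N, φ n = f n := by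
  obtain ⟨ψ, hψ, hbasis⟩ := ((nhds_hasBasis_iota x).restrict_subset
    ((isOpen_iota (f N)).mem_nhds hx)).exists_antitone_subbasis
  obtain ⟨φ, hle, hgt⟩ : ∃ φ : ℕ → ℕ, (∀ n ≤ N, φ n = f n) ∧ ∀ n, N < n → φ n = ψ n :=
    ⟨fun n => if n ≤ N then f n else ψ n, fun _ hn => if_pos hn, fun _ hn => if_neg hn.not_ge⟩
  refine ⟨φ, ⟨(nhds_hasBasis_iota x).to_hasBasis (fun s hs => ?_) fun n _ => ?_, fun a b hab => ?_⟩,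
    hle⟩
  · obtain ⟨n, hn⟩ := hbasis.mem_iff.1 ((isOpen_iota s).mem_nhds hs)
    refine ⟨max n (N + 1), trivial, ?_⟩
    rw [hgt _ (Nat.lt_of_succ_le (le_max_right _ _))]
    exact (hbasis.antitone (le_max_left _ _)).trans hn
  · refine ⟨φ n, ?_, subset_rfl⟩
    rcases le_or_gt n N with hn | hn
    · rw [hle n hn]
      exact hf hn self_mem_Iic hn hx
    · rw [hgt n hn]
      exact (hψ n).1
  · rcases le_or_gt b N with hb | hb
    · simpa only [hle b hb, hle a (hab.trans hb)] using hf (hab.trans hb) hb hab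
    · simp only [hgt b hb]
      rcases le_or_gt a N with ha | ha
      · simpa only [hle a ha] using (hψ b).2.trans (hf ha self_mem_Iic ha)
      · simpa only [hgt a ha] using hbasis.antitone hab

namespace CodedBasis

variable {X : Type} {τ : CodedBasis X}

/-- The codes of the basis elements that meet `A`: the basic representation of a closed set. -/
def meetingCodes (τ : CodedBasis X) (A : Set X) : Set ℕ :=
  {s ∈ τ.dom | (τ.coding s ∩ A).Nonempty}

theorem isBasicRepresentation_meetingCodes [TopologicalSpace X]
    (hbasis : TopologicalSpace.IsTopologicalBasis τ.basis) (hcode : τ.basis ⊆ range τ.coding)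
    {A : Set X} (hA : IsClosed A) : τ.IsBasicRepresentation (τ.meetingCodes A) A := by
  refine ⟨fun s hs => hs.1, fun x => ⟨fun hx => ?_, ?_⟩⟩
  · refine ⟨{U ∈ τ.basis | x ∈ U}, ⟨fun U hU => hU.1, fun U hU => hU.2,
      fun V hV hxV => ⟨V, ⟨hV, hxV⟩, subset_rfl⟩⟩, ?_⟩
    rintro U ⟨hU, hxU⟩
    obtain ⟨s, rfl⟩ := hcode hU
    exact ⟨s, ⟨hU, x, hxU, hx⟩, rfl⟩
  · rintro ⟨L, ⟨-, -, hL⟩, hLA⟩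
    refine hA.closure_subset (hbasis.mem_closure_iff.2 fun V hV hxV => ?_)
    obtain ⟨U, hU, hUV⟩ := hL V hV hxV
    obtain ⟨s, ⟨-, hs⟩, rfl⟩ := hLA hU
    exact hs.mono (inter_subset_inter_left A hUV)

variable {n : ℕ} {τ : Fin n → CodedBasis X}

theorem isTopologicalBasis_product [TopologicalSpace X]
    (hτ : ∀ i, TopologicalSpace.IsTopologicalBasis (τ i).basis) :
    TopologicalSpace.IsTopologicalBasis (product τ).basis := by
  refine TopologicalSpace.isTopologicalBasis_of_isOpen_of_nhds ?_ fun x U hx hU => ?_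
  · rintro _ ⟨V, hV, rfl⟩
    exact isOpen_set_pi finite_univ fun i _ => (hτ i).isOpen (hV i)
  · obtain ⟨u, hu, huU⟩ := isOpen_pi_iff'.1 hU x hx
    choose V hV hxV hVu using fun i => (hτ i).exists_subset_of_mem_open (hu i).2 (hu i).1
    exact ⟨univ.pi V, ⟨V, hV, rfl⟩, fun i _ => hxV i, (pi_mono fun i _ => hVu i).trans huU⟩

theorem product_basis_subset_range_coding (hτ : ∀ i, (τ i).basis ⊆ range (τ i).coding) :
    (product τ).basis ⊆ range (product τ).coding := by
  rintro _ ⟨V, hV, rfl⟩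
  choose a ha using fun i => hτ i (hV i)
  refine ⟨seqCode a, ?_⟩
  simp only [product, seqProj_seqCode, ha]

theorem mem_meetingCodes_product_iff {A : Set (Fin n → X)} {s : ℕ} :
    s ∈ (product τ).meetingCodes A ↔ (∀ i, seqProj i s ∈ (τ i).dom) ∧
      ∃ z ∈ A, ∀ i, z i ∈ (τ i).coding (seqProj i s) := by
  constructor
  · rintro ⟨⟨V, hV, hsV⟩, z, hzs, hzA⟩
    refine ⟨fun i => ?_, z, hzA, fun i => hzs i trivial⟩
    have hV_eq : V i = (τ i).coding (seqProj i s) := by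
      have hVne : (univ.pi V).Nonempty := ⟨z, hsV.subset hzs⟩
      rw [← eval_image_univ_pi hVne, ← hsV]
      exact eval_image_univ_pi ⟨z, hzs⟩
    change (τ i).coding _ ∈ (τ i).basis
    exact hV_eq ▸ hV i
  · rintro ⟨hdom, z, hzA, hzs⟩
    exact ⟨⟨_, hdom, rfl⟩, z, fun i _ => hzs i, hzA⟩

end CodedBasis

theorem isTopologicalBasis_decimalIntervals {c : ℚ} (hc : 0 < c) :
    TopologicalSpace.IsTopologicalBasis (decimalIntervals c).basis := by
  have hc' : (0 : ℝ) < c := Rat.cast_pos.2 hc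
  refine TopologicalSpace.isTopologicalBasis_of_isOpen_of_nhds ?_ fun x U hx hU => ?_
  · rintro _ ⟨m, n, -, rfl⟩
    exact isOpen_Ioo
  obtain ⟨ε, hε, hεU⟩ := Metric.isOpen_iff.1 hU x hx
  obtain ⟨n, hn⟩ := pow_unbounded_of_one_lt ((1 + c) / ε) (by norm_num : (1 : ℝ) < 10)
  set D : ℝ := 10 ^ (n + 1)
  have hD : 0 < D := by positivity
  have hlen : 1 + c < ε * D := by
    rw [div_lt_iff₀ hε] at hn
    exact hn.trans_le (by rw [mul_comm]; gcongr; exact pow_le_pow_right₀ (by norm_num) n.le_succ)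
  have hle := Int.floor_le (x * D)
  have hlt := Int.lt_floor_add_one (x * D)
  refine ⟨_, ⟨⌊x * D⌋, n + 1, n.succ_pos, rfl⟩, ?_, Subset.trans ?_ hεU⟩
  · rw [← sub_div, ← add_div]
    exact ⟨by rw [div_lt_iff₀ hD]; linarith, by rw [lt_div_iff₀ hD]; linarith⟩
  · rw [Real.ball_eq_Ioo, ← sub_div, ← add_div]
    exact Ioo_subset_Ioo (by rw [le_div_iff₀ hD]; linarith) (by rw [div_le_iff₀ hD]; linarith)

theorem decimalIntervals_basis_subset_range_coding (c : ℚ) :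
    (decimalIntervals c).basis ⊆ range (decimalIntervals c).coding := by
  rintro _ ⟨m, n, -, rfl⟩
  refine ⟨ratPair (m / 10 ^ n - c / 10 ^ n) ((m + 1) / 10 ^ n + c / 10 ^ n), ?_⟩
  change iota _ = _
  rw [iota_ratPair]
  push_cast
  rfl

theorem isEffectiveTopology_decimalIntervals {c : ℚ} (hc : 0 < c) :
    (decimalIntervals c).IsEffectiveTopology :=
  ⟨⟨inferInstance, isTopologicalBasis_decimalIntervals hc, inferInstance⟩,
    decimalIntervals_basis_subset_range_coding c⟩

/-- The code `s` stands for the decimal interval with `m = e.1 - e.2.1` and `d = e.2.2 + 1`. -/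
def HasDecimalEndpoints (c : ℚ) (s : ℕ) (e : ℕ × ℕ × ℕ) : Prop :=
  lower s = (e.1 - e.2.1 - c) / 10 ^ (e.2.2 + 1) ∧
    upper s = (e.1 - e.2.1 + 1 + c) / 10 ^ (e.2.2 + 1)

theorem mem_decimalIntervals_dom_iff {c : ℚ} (hc : 0 < c) {s : ℕ} :
    s ∈ (decimalIntervals c).dom ↔ ∃ e, HasDecimalEndpoints c s e := by
  have hiff (m : ℤ) (d : ℕ) :
      iota s = Ioo ((m : ℝ) / 10 ^ (d + 1) - (c : ℝ) / 10 ^ (d + 1))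
        (((m : ℝ) + 1) / 10 ^ (d + 1) + (c : ℝ) / 10 ^ (d + 1)) ↔
      lower s = (m - c) / 10 ^ (d + 1) ∧ upper s = (m + 1 + c) / 10 ^ (d + 1) := by
    rw [← iota_eq_Ioo_iff (by gcongr; linarith)]
    push_cast
    rw [sub_div, add_div _ (c : ℝ)]
  constructor
  · rintro ⟨m, n, hn, h⟩
    obtain ⟨d, rfl⟩ := Nat.exists_eq_succ_of_ne_zero hn.ne'
    refine ⟨(m.toNat, (-m).toNat, d), ?_⟩
    have hm : (m : ℚ) = m.toNat - (-m).toNat := by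
      exact_mod_cast m.toNat_sub_toNat_neg.symm
    rw [HasDecimalEndpoints, ← hm]
    exact (hiff m d).1 h
  · rintro ⟨⟨m₁, m₂, d⟩, h⟩
    refine ⟨m₁ - m₂, d + 1, d.succ_pos, (hiff _ d).2 ?_⟩
    push_cast
    exact h

theorem primrecRel_hasDecimalEndpoints {c : ℚ} (hc : 0 < c) :
    PrimrecRel (HasDecimalEndpoints c) := by
  have hpow : Primrec fun e : ℕ × ℕ × ℕ => c.den * 10 ^ (e.2.2 + 1) :=
    Primrec.nat_mul.comp (Primrec.const c.den)
      (primrec_nat_pow.comp (Primrec.const 10) (Primrec.succ.comp (Primrec.snd.comp Primrec.snd)))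
  have hmul₁ : Primrec fun e : ℕ × ℕ × ℕ => e.1 * c.den :=
    Primrec.nat_mul.comp Primrec.fst (Primrec.const c.den)
  have hmul₂ : Primrec fun e : ℕ × ℕ × ℕ => e.2.1 * c.den :=
    Primrec.nat_mul.comp (Primrec.fst.comp Primrec.snd) (Primrec.const c.den)
  have hpos (d : ℕ) : 0 < c.den * 10 ^ (d + 1) := Nat.mul_pos c.den_pos (by positivity)
  have hdiv (x : ℚ) (d : ℕ) : x / 10 ^ (d + 1) = x * c.den / ↑(c.den * 10 ^ (d + 1)) := by
    have := c.den_pos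
    push_cast
    field_simp
  have hc_mul : c * c.den = c.num.natAbs := by
    rw [Rat.mul_den_eq_num, ← Int.cast_natCast, Int.natAbs_of_nonneg (Rat.num_nonneg.2 hc.le)]
  have hlower : PrimrecRat fun e : ℕ × ℕ × ℕ => ((e.1 - e.2.1 - c) / 10 ^ (e.2.2 + 1) : ℚ) := by
    refine ⟨_, _, _, hmul₁, Primrec.nat_add.comp hmul₂ (Primrec.const c.num.natAbs), hpow,
      fun e => ⟨hpos _, ?_⟩⟩
    dsimp only
    rw [hdiv, sub_mul, hc_mul]
    push_cast
    ring
  have hupper : PrimrecRat fun e : ℕ × ℕ × ℕ => ((e.1 - e.2.1 + 1 + c) / 10 ^ (e.2.2 + 1) : ℚ) := by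
    refine ⟨_, _, _, Primrec.nat_add.comp hmul₁ (Primrec.const (c.den + c.num.natAbs)), hmul₂,
      hpow, fun e => ⟨hpos _, ?_⟩⟩
    dsimp only
    rw [hdiv, add_mul, hc_mul]
    push_cast
    ring
  exact ((primrecRat_lower.comp Primrec.fst).eq (hlower.comp Primrec.snd)).and
    ((primrecRat_upper.comp Primrec.fst).eq (hupper.comp Primrec.snd))

/-- The configuration with instruction number `c.1` whose registers hold `c.2`, followed by
zeros. Only such configurations occur in a computation. -/
def configOfList (c : ℕ × List ℕ) : Config := ⟨c.1, fun r => c.2.getD r 0⟩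

/-- The list of register contents after storing `v` in register `r`; it is filled up with zeros
if register `r` lies beyond its end. -/
def setReg (L : List ℕ) (r v : ℕ) : List ℕ :=
  (List.range (max L.length (r + 1))).map fun i => if i = r then v else L.getD i 0

theorem configOfList_setReg (q : ℕ) (L : List ℕ) (r v : ℕ) :
    configOfList (q, setReg L r v) = ⟨q, Function.update (fun j => L.getD j 0) r v⟩ := by
  rw [configOfList, Config.mk.injEq]
  refine ⟨rfl, funext fun i => ?_⟩
  rw [setReg, Function.update_apply, List.getD_eq_getElem?_getD, List.getElem?_map]
  rcases lt_or_ge i (max L.length (r + 1)) with h | h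
  · simp [List.getElem?_range h]
  · obtain ⟨hL, hr⟩ := max_le_iff.1 h
    simp [List.getElem?_eq_none, h, hL, (Nat.lt_of_succ_le hr).ne']

/-- `Instr.run` on configurations given by lists. -/
def Instr.runList {k : ℕ} (φ : Fin k → ℕ → ℕ) (c : ℕ × List ℕ) : Instr k → ℕ × List ℕ
  | .zero r => (c.1 + 1, setReg c.2 r 0)
  | .succ r => (c.1 + 1, setReg c.2 r (c.2.getD r 0 + 1))
  | .copy r s => (c.1 + 1, setReg c.2 s (c.2.getD r 0))
  | .jump r s q => (if c.2.getD r 0 = c.2.getD s 0 then q else c.1 + 1, c.2)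
  | .query i r => (c.1 + 1, setReg c.2 r (φ i (c.2.getD r 0)))

theorem Instr.configOfList_runList {k : ℕ} (φ : Fin k → ℕ → ℕ) (c : ℕ × List ℕ) (I : Instr k) :
    configOfList (I.runList φ c) = I.run φ (configOfList c) := by
  cases I <;> simp only [runList, configOfList_setReg, run] <;> rfl

namespace OracleProgram

/-- `OracleProgram.step` on configurations given by lists. -/
def stepList {k : ℕ} (P : OracleProgram k) (φ : Fin k → ℕ → ℕ) (c : ℕ × List ℕ) :
    Option (ℕ × List ℕ) :=
  P[c.1]?.map (Instr.runList φ c)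

theorem step_configOfList {k : ℕ} (P : OracleProgram k) (φ : Fin k → ℕ → ℕ) (c : ℕ × List ℕ) :
    P.step φ (configOfList c) = (P.stepList φ c).map configOfList := by
  simp only [step, stepList, Option.map_map, configOfList]
  congr 1
  exact funext fun I => (I.configOfList_runList φ c).symm

/-- The output of a program on input `l` if it halts after exactly `n` steps. -/
def evalSteps {k : ℕ} (P : OracleProgram k) (φ : Fin k → ℕ → ℕ) (l n : ℕ) : Option ℕ :=
  ((fun o : Option (ℕ × List ℕ) => o.bind (P.stepList φ))^[n] (some (0, [l]))).bind fun c =>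
    if P.length ≤ c.1 then some (c.2.getD 0 0) else none

end OracleProgram

theorem reaches_iff_exists_iterate {σ : Type*} {f : σ → Option σ} {a b : σ} :
    StateTransition.Reaches f a b ↔ ∃ n, (fun o : Option σ => o.bind f)^[n] (some a) = some b := by
  constructor
  · intro h
    induction h with
    | refl => exact ⟨0, rfl⟩
    | tail _ h ih =>
      obtain ⟨n, hn⟩ := ih
      refine ⟨n + 1, ?_⟩
      rw [Function.iterate_succ_apply', hn]
      exact h
  · rintro ⟨n, hn⟩
    induction n generalizing b with
    | zero =>
      cases hn
      exact Relation.ReflTransGen.refl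
    | succ n ih =>
      rw [Function.iterate_succ_apply'] at hn
      obtain ⟨c, hc, hcb⟩ := Option.bind_eq_some_iff.1 hn
      exact (ih hc).tail hcb

namespace OracleProgram

variable {k : ℕ} {P : OracleProgram k} {φ : Fin k → ℕ → ℕ} {l v : ℕ}

theorem eval_step_configOfList (c : ℕ × List ℕ) :
    StateTransition.eval (P.step φ) (configOfList c) =
      (StateTransition.eval (P.stepList φ) c).map configOfList := by
  refine StateTransition.tr_eval' _ _ _ (StateTransition.fun_respects.2 fun c => ?_) c
  have hc := step_configOfList P φ c
  cases h : P.stepList φ c with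
  | none => simpa [StateTransition.FRespects, h] using hc
  | some c' =>
    rw [h] at hc
    exact Relation.TransGen.single hc

theorem mem_eval_iff_exists_evalSteps : v ∈ P.eval φ l ↔ ∃ n, P.evalSteps φ l n = some v := by
  have hinit : (⟨0, Function.update (fun _ => 0) 0 l⟩ : Config) = configOfList (0, [l]) := by
    rw [configOfList, Config.mk.injEq]
    refine ⟨rfl, funext fun r => ?_⟩
    cases r <;> simp
  have hhalt (c : ℕ × List ℕ) : P.stepList φ c = none ↔ P.length ≤ c.1 := by
    simp [stepList]
  simp only [eval, hinit, eval_step_configOfList, Part.map_map, Part.mem_map_iff,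
    StateTransition.mem_eval, reaches_iff_exists_iterate, evalSteps, Option.bind_eq_some_iff, hhalt]
  constructor
  · rintro ⟨c, ⟨⟨n, hn⟩, hc⟩, rfl⟩
    exact ⟨n, c, hn, if_pos hc⟩
  · rintro ⟨n, c, hn, hv⟩
    obtain ⟨hc, hv⟩ := Option.ite_none_right_eq_some.1 hv
    exact ⟨c, ⟨⟨n, hn⟩, hc⟩, Option.some_inj.1 hv⟩

end OracleProgram

theorem Instr.exists_forall_run_eq {k : ℕ} (I : Instr k) (φ : Fin k → ℕ → ℕ) (C : Config) :
    ∃ N, ∀ φ' : Fin k → ℕ → ℕ, (∀ i, ∀ n ≤ N, φ' i n = φ i n) → I.run φ' C = I.run φ C := by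
  cases I with
  | query i r => exact ⟨C.reg r, fun φ' h => by rw [run, run, h i _ le_rfl]⟩
  | _ => exact ⟨0, fun _ _ => rfl⟩

namespace OracleProgram

variable {k : ℕ} {P : OracleProgram k} {φ : Fin k → ℕ → ℕ} {l v : ℕ}

theorem exists_forall_reaches {A C : Config} (h : StateTransition.Reaches (P.step φ) A C) :
    ∃ N, ∀ φ' : Fin k → ℕ → ℕ, (∀ i, ∀ n ≤ N, φ' i n = φ i n) →
      StateTransition.Reaches (P.step φ') A C := by
  induction h with
  | refl => exact ⟨0, fun _ _ => Relation.ReflTransGen.refl⟩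
  | @tail B _ _ hstep ih =>
    obtain ⟨N, hN⟩ := ih
    obtain ⟨I, hI, rfl⟩ := Option.map_eq_some_iff.1 hstep
    obtain ⟨N', hN'⟩ := I.exists_forall_run_eq φ B
    refine ⟨max N N', fun φ' h => ?_⟩
    refine (hN φ' fun i n hn => h i n (hn.trans (le_max_left _ _))).tail ?_
    refine Option.map_eq_some_iff.2 ⟨I, hI, ?_⟩
    exact hN' φ' fun i n hn => h i n (hn.trans (le_max_right _ _))

theorem exists_forall_mem_eval (h : v ∈ P.eval φ l) :
    ∃ N, ∀ φ' : Fin k → ℕ → ℕ, (∀ i, ∀ n ≤ N, φ' i n = φ i n) → v ∈ P.eval φ' l := by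
  obtain ⟨C, hC, rfl⟩ := (Part.mem_map_iff _).1 h
  obtain ⟨hreach, hhalt⟩ := StateTransition.mem_eval.1 hC
  obtain ⟨N, hN⟩ := exists_forall_reaches hreach
  refine ⟨N, fun φ' hφ' => Part.mem_map _ (StateTransition.mem_eval.2 ⟨hN φ' hφ', ?_⟩)⟩
  simpa [step] using hhalt

end OracleProgram

section

variable {α β γ σ : Type*} [Primcodable α] [Primcodable β] [Primcodable γ] [Primcodable σ]

theorem primrec₂_sum {f : α → β ⊕ γ → σ} (hl : Primrec₂ fun a b => f a (.inl b))
    (hr : Primrec₂ fun a c => f a (.inr c)) : Primrec₂ f :=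
  (Primrec.sumCasesOn Primrec.snd (hl.comp (Primrec.fst.comp Primrec.fst) Primrec.snd).to₂
    (hr.comp (Primrec.fst.comp Primrec.fst) Primrec.snd).to₂).of_eq fun ⟨_, x⟩ => by
    cases x <;> rfl

theorem primrec₂_instr {k : ℕ} {f : α → Instr k → σ} (hzero : Primrec₂ fun a r => f a (.zero r))
    (hsucc : Primrec₂ fun a r => f a (.succ r))
    (hcopy : Primrec₂ fun a (p : ℕ × ℕ) => f a (.copy p.1 p.2))
    (hjump : Primrec₂ fun a (p : ℕ × ℕ × ℕ) => f a (.jump p.1 p.2.1 p.2.2))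
    (hquery : Primrec₂ fun a (p : Fin k × ℕ) => f a (.query p.1 p.2)) : Primrec₂ f := by
  have h : Primrec₂ fun a x => f a ((Instr.equivSum k).symm x) :=
    primrec₂_sum hzero (primrec₂_sum hsucc (primrec₂_sum hcopy (primrec₂_sum hjump hquery)))
  exact (h.comp Primrec.fst (Primrec.of_equiv.comp Primrec.snd)).of_eq fun p => by simp

theorem primrec_setReg {L : α → List ℕ} {r v : α → ℕ} (hL : Primrec L) (hr : Primrec r)
    (hv : Primrec v) : Primrec fun a => setReg (L a) (r a) (v a) :=
  Primrec.list_map (Primrec.list_range.comp (Primrec.nat_max.comp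
    (Primrec.list_length.comp hL) (Primrec.succ.comp hr)))
    (Primrec.ite (Primrec.eq.comp Primrec.snd (hr.comp Primrec.fst)) (hv.comp Primrec.fst)
      ((Primrec.list_getD 0).comp (hL.comp Primrec.fst) Primrec.snd))

variable {k : ℕ} {φ : α → Fin k → ℕ → ℕ}

theorem primrec_runList (hφ : Primrec fun p : α × Fin k × ℕ => φ p.1 p.2.1 p.2.2)
    {c : α → ℕ × List ℕ} (hc : Primrec c) :
    Primrec₂ fun a (I : Instr k) => I.runList (φ a) (c a) := by
  have next {δ : Type} [Primcodable δ] : Primrec fun p : α × δ => (c p.1).1 + 1 :=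
    Primrec.succ.comp (Primrec.fst.comp (hc.comp Primrec.fst))
  have reg {δ : Type} [Primcodable δ] : Primrec fun p : α × δ => (c p.1).2 :=
    Primrec.snd.comp (hc.comp Primrec.fst)
  have get {δ : Type} [Primcodable δ] {r : α × δ → ℕ} (hr : Primrec r) :
      Primrec fun p : α × δ => (c p.1).2.getD (r p) 0 :=
    (Primrec.list_getD 0).comp reg hr
  have set {δ : Type} [Primcodable δ] {r v : α × δ → ℕ} (hr : Primrec r) (hv : Primrec v) :
      Primrec fun p : α × δ => ((c p.1).1 + 1, setReg (c p.1).2 (r p) (v p)) :=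
    next.pair (primrec_setReg reg hr hv)
  have fst_snd {δ ε : Type} [Primcodable δ] [Primcodable ε] :
      Primrec fun p : α × δ × ε => p.2.1 := Primrec.fst.comp Primrec.snd
  have snd_snd {δ ε : Type} [Primcodable δ] [Primcodable ε] :
      Primrec fun p : α × δ × ε => p.2.2 := Primrec.snd.comp Primrec.snd
  refine primrec₂_instr (set Primrec.snd (Primrec.const 0))
    (set Primrec.snd (Primrec.succ.comp (get Primrec.snd))) (set snd_snd (get fst_snd)) ?_
    (set snd_snd (hφ.comp (Primrec.fst.pair (fst_snd.pair (get snd_snd)))))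
  exact (Primrec.ite (Primrec.eq.comp (get fst_snd) (get (Primrec.fst.comp snd_snd)))
    (Primrec.snd.comp snd_snd) next).pair reg

theorem primrec_evalSteps (hφ : Primrec fun p : α × Fin k × ℕ => φ p.1 p.2.1 p.2.2)
    {P : α → OracleProgram k} {l n : α → ℕ} (hP : Primrec P) (hl : Primrec l) (hn : Primrec n) :
    Primrec fun a => (P a).evalSteps (φ a) (l a) (n a) := by
  refine Primrec.option_bind (Primrec.nat_iterate hn (Primrec.option_some.comp
    ((Primrec.const 0).pair (Primrec.list_cons.comp hl (Primrec.const [])))) ?_) ?_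
  · refine Primrec.option_bind Primrec.snd (Primrec.option_map (Primrec.list_getElem?.comp
      (hP.comp (Primrec.fst.comp Primrec.fst)) (Primrec.fst.comp Primrec.snd)) ?_)
    exact primrec_runList (φ := fun p : (α × Option (ℕ × List ℕ)) × ℕ × List ℕ => φ p.1.1)
      (hφ.comp ((Primrec.fst.comp (Primrec.fst.comp Primrec.fst)).pair Primrec.snd)) Primrec.snd
  · exact Primrec.ite (Primrec.nat_le.comp (Primrec.list_length.comp (hP.comp Primrec.fst))
      (Primrec.fst.comp Primrec.snd)) (Primrec.option_some.comp ((Primrec.list_getD 0).comp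
        (Primrec.snd.comp Primrec.snd) (Primrec.const 0))) (Primrec.const none)

end

/-- `P` realizes `ψ`: it maps nested oracles for the arguments of `ψ` to nested oracles for its
values. This is the condition in Kreisel's criterion, stated with bases of neighborhood filters. -/
def Realizes {k m : ℕ} (P : Fin m → OracleProgram k) (ψ : (Fin k → ℝ) → Fin m → ℝ) : Prop :=
  ∀ (x : Fin k → ℝ) (φ : Fin k → ℕ → ℕ),
    (∀ i, (𝓝 (x i)).HasAntitoneBasis fun n => iota (φ i n)) →
    ∀ j, ∃ κ : ℕ → ℕ, (∀ l, (P j).eval φ l = Part.some (κ l)) ∧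
      (𝓝 (ψ x j)).HasAntitoneBasis fun l => iota (κ l)

theorem kreiselPrograms_iff_exists_realizes {k m : ℕ} {M : PhysicalModel (Fin (k + m) → ℝ) ℝ}
    {P : Fin m → OracleProgram k} :
    M.KreiselPrograms P ↔ ∃ ψ, M.IsInducedBy ψ ∧ Realizes P ψ := by
  simp only [PhysicalModel.KreiselPrograms, Realizes, isNestedOracle_iff_hasAntitoneBasis]

theorem OracleProgram.eventually_mem_eval_min {k : ℕ} {P : OracleProgram k} {φ : Fin k → ℕ → ℕ}
    {l v : ℕ} (h : v ∈ P.eval φ l) : ∀ᶠ N in atTop, v ∈ P.eval (fun i n => φ i (min n N)) l := by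
  obtain ⟨N, hN⟩ := exists_forall_mem_eval h
  filter_upwards [eventually_ge_atTop N] with N' hN'
  exact hN _ fun i n hn => by rw [min_eq_left (hn.trans hN')]

namespace Realizes

variable {k m : ℕ} {P : Fin m → OracleProgram k} {ψ : (Fin k → ℝ) → Fin m → ℝ}

/-- A computation inspects only finitely many of the intervals `θ i n`, so it cannot tell `θ` from
a nested oracle for `x` that extends these. -/
theorem mem_iota_of_mem_eval (h : Realizes P ψ) {x : Fin k → ℝ} {θ : Fin k → ℕ → ℕ}
    (hθ : ∀ i, Antitone fun n => iota (θ i n)) (hx : ∀ i n, x i ∈ iota (θ i n)) {j : Fin m}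
    {l v : ℕ} (hv : v ∈ (P j).eval θ l) : ψ x j ∈ iota v := by
  obtain ⟨N, hN⟩ := OracleProgram.exists_forall_mem_eval hv
  choose φ hφ hφθ using fun i =>
    exists_hasAntitoneBasis_iota_extending ((hθ i).antitoneOn (Iic N)) (hx i N)
  obtain ⟨κ, hκ, hbasis⟩ := h x φ hφ j
  have hvκ := hN φ hφθ
  rw [hκ l, Part.mem_some_iff] at hvκ
  rw [hvκ]
  exact mem_of_mem_nhds (hbasis.mem l)

theorem exists_mem_eval_subset (h : Realizes P ψ) {x : Fin k → ℝ} {φ : Fin k → ℕ → ℕ}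
    (hφ : ∀ i, (𝓝 (x i)).HasAntitoneBasis fun n => iota (φ i n)) {j : Fin m} {U : Set ℝ}
    (hU : U ∈ 𝓝 (ψ x j)) : ∃ l v, v ∈ (P j).eval φ l ∧ iota v ⊆ U := by
  obtain ⟨κ, hκ, hbasis⟩ := h x φ hφ j
  obtain ⟨l, hl⟩ := hbasis.mem_iff.1 hU
  exact ⟨l, κ l, Part.eq_some_iff.1 (hκ l), hl⟩

theorem continuous (h : Realizes P ψ) : Continuous ψ := by
  refine continuous_pi fun j => continuous_iff_continuousAt.2 fun x U hU => ?_
  choose φ hφ using fun i => exists_hasAntitoneBasis_iota (x i)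
  obtain ⟨l, v, hv, hvU⟩ := h.exists_mem_eval_subset hφ hU
  obtain ⟨N, hN⟩ := (OracleProgram.eventually_mem_eval_min hv).exists
  have hnear : ∀ᶠ y in 𝓝 x, ∀ i, y i ∈ iota (φ i N) :=
    eventually_all.2 fun i => (continuous_apply i).continuousAt.eventually_mem ((hφ i).mem N)
  change ∀ᶠ y in 𝓝 x, ψ y j ∈ U
  filter_upwards [hnear] with y hy
  refine hvU (h.mem_iota_of_mem_eval (fun i a b hab => ?_) (fun i n => ?_) hN)
  · exact (hφ i).antitone (min_le_min_right N hab)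
  · exact (hφ i).antitone (min_le_right n N) (hy i)

end Realizes

theorem PhysicalModel.KreiselPrograms.isClosed_states {k m : ℕ}
    {M : PhysicalModel (Fin (k + m) → ℝ) ℝ} {P : Fin m → OracleProgram k}
    (h : M.KreiselPrograms P) : IsClosed M.states := by
  obtain ⟨ψ, hM, hψ⟩ := kreiselPrograms_iff_exists_realizes.1 h
  rw [hM.2]
  exact isClosed_eq (hψ.continuous.comp (by fun_prop)) (by fun_prop)

/-- An eventually constant oracle as a finite object: the values in the list `D.1`, followed by
the constant value `D.2`. -/
def finiteOracle (D : List ℕ × ℕ) (n : ℕ) : ℕ := D.1.getD n D.2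

theorem finiteOracle_of_length_le {D : List ℕ × ℕ} {n : ℕ} (hn : D.1.length ≤ n) :
    finiteOracle D n = D.2 :=
  List.getD_eq_default _ _ hn

theorem finiteOracle_map_range (φ : ℕ → ℕ) (N : ℕ) :
    finiteOracle ((List.range N).map φ, φ N) = fun n => φ (min n N) := by
  funext n
  rcases lt_or_ge n N with hn | hn
  · simp [finiteOracle, hn, hn.le]
  · rw [finiteOracle_of_length_le (by simpa using hn), min_eq_right hn]

theorem antitone_iota_finiteOracle_iff {D : List ℕ × ℕ} :
    (Antitone fun n => iota (finiteOracle D n)) ↔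
      ∀ n < D.1.length, iota (finiteOracle D (n + 1)) ⊆ iota (finiteOracle D n) := by
  refine ⟨fun h n _ => h n.le_succ, fun h => antitone_nat_of_succ_le fun n => ?_⟩
  rcases lt_or_ge n D.1.length with hn | hn
  · exact h n hn
  · rw [finiteOracle_of_length_le hn, finiteOracle_of_length_le (hn.trans n.le_succ)]

/-- A finite certificate that the graph of the function realized by `P` meets the box with sides
`iota (B i)`: finite oracles `D` whose last intervals lie in the first `k` sides, and for each `j` a
computation from `D` with input `(w j).1`, length `(w j).2.1` and output `(w j).2.2` that confines
the `j`-th value to the corresponding side. -/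
def Certifies {k m : ℕ} (P : Fin m → OracleProgram k) (B : Fin (k + m) → ℕ)
    (D : Fin k → List ℕ × ℕ) (w : Fin m → ℕ × ℕ × ℕ) : Prop :=
  (∀ i, (Antitone fun n => iota (finiteOracle (D i) n)) ∧ (iota (D i).2).Nonempty ∧
    iota (D i).2 ⊆ iota (B (Fin.castAdd m i))) ∧
  ∀ j, (P j).evalSteps (fun i => finiteOracle (D i)) (w j).1 (w j).2.1 = some (w j).2.2 ∧
    iota (w j).2.2 ⊆ iota (B (Fin.natAdd k j))

namespace Realizes

variable {k m : ℕ} {P : Fin m → OracleProgram k} {ψ : (Fin k → ℝ) → Fin m → ℝ}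
  {B : Fin (k + m) → ℕ}

theorem exists_forall_mem_iota_of_certifies (h : Realizes P ψ) {D : Fin k → List ℕ × ℕ}
    {w : Fin m → ℕ × ℕ × ℕ} (hD : Certifies P B D w) :
    ∃ x, ∀ i, (Fin.append x (ψ x) : Fin (k + m) → ℝ) i ∈ iota (B i) := by
  choose x hx using fun i => (hD.1 i).2.1
  have hx_mem (i : Fin k) (n : ℕ) : x i ∈ iota (finiteOracle (D i) n) := by
    refine (hD.1 i).1 (le_max_left n (D i).1.length) ?_
    dsimp only
    rw [finiteOracle_of_length_le (le_max_right _ _)]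
    exact hx i
  refine ⟨x, fun i => ?_⟩
  cases i using Fin.addCases with
  | left i =>
    rw [Fin.append_left]
    exact (hD.1 i).2.2 (hx i)
  | right j =>
    rw [Fin.append_right]
    have heval := OracleProgram.mem_eval_iff_exists_evalSteps.2 ⟨_, (hD.2 j).1⟩
    exact (hD.2 j).2 (h.mem_iota_of_mem_eval (fun i => (hD.1 i).1) hx_mem heval)

theorem exists_certifies (h : Realizes P ψ) {x : Fin k → ℝ}
    (hx : ∀ i, (Fin.append x (ψ x) : Fin (k + m) → ℝ) i ∈ iota (B i)) :
    ∃ D w, Certifies P B D w := by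
  choose φ hφ using fun i => exists_hasAntitoneBasis_iota (x i)
  have hnhds (j : Fin m) : iota (B (Fin.natAdd k j)) ∈ 𝓝 (ψ x j) :=
    (isOpen_iota _).mem_nhds (by simpa using hx (Fin.natAdd k j))
  choose l v hv hvB using fun j => h.exists_mem_eval_subset hφ (hnhds j)
  have hsub (i : Fin k) : ∀ᶠ N in atTop, iota (φ i N) ⊆ iota (B (Fin.castAdd m i)) :=
    (hφ i).eventually_subset ((isOpen_iota _).mem_nhds (by simpa using hx (Fin.castAdd m i)))
  obtain ⟨N, hNB, hN⟩ := ((eventually_all.2 hsub).and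
    (eventually_all.2 fun j => OracleProgram.eventually_mem_eval_min (hv j))).exists
  choose n hn using fun j => OracleProgram.mem_eval_iff_exists_evalSteps.1 (hN j)
  refine ⟨fun i => ((List.range N).map (φ i), φ i N), fun j => (l j, n j, v j),
    fun i => ⟨?_, ⟨x i, mem_of_mem_nhds ((hφ i).mem N)⟩, hNB i⟩, fun j => ⟨?_, hvB j⟩⟩
  · rw [finiteOracle_map_range]
    exact fun a b hab => (hφ i).antitone (min_le_min_right N hab)
  · simpa only [finiteOracle_map_range] using hn j

end Realizes

theorem PhysicalModel.KreiselPrograms.exists_mem_states_iff_exists_certifies {k m : ℕ}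
    {M : PhysicalModel (Fin (k + m) → ℝ) ℝ} {P : Fin m → OracleProgram k}
    (h : M.KreiselPrograms P) (B : Fin (k + m) → ℕ) :
    (∃ z ∈ M.states, ∀ i, z i ∈ iota (B i)) ↔ ∃ D w, Certifies P B D w := by
  obtain ⟨ψ, hM, hψ⟩ := kreiselPrograms_iff_exists_realizes.1 h
  rw [hM.2]
  constructor
  · rintro ⟨z, hz, hzB⟩
    refine hψ.exists_certifies (x := fun i => z (Fin.castAdd m i)) fun i => ?_
    rw [show ψ _ = _ from hz, Fin.append_castAdd_natAdd]
    exact hzB i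
  · rintro ⟨D, w, hD⟩
    obtain ⟨x, hx⟩ := hψ.exists_forall_mem_iota_of_certifies hD
    exact ⟨Fin.append x (ψ x), by simp, hx⟩

theorem primrec₂_finiteOracle : Primrec₂ finiteOracle :=
  (Primrec.option_getD.comp (Primrec.list_getElem?.comp (Primrec.fst.comp Primrec.fst) Primrec.snd)
    (Primrec.snd.comp Primrec.fst)).of_eq fun _ => (List.getD_eq_getElem?_getD).symm

theorem primrecPred_antitone_iota_finiteOracle :
    PrimrecPred fun D : List ℕ × ℕ => Antitone fun n => iota (finiteOracle D n) := by
  have hstep : PrimrecRel fun (D : List ℕ × ℕ) n =>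
      iota (finiteOracle D (n + 1)) ⊆ iota (finiteOracle D n) :=
    primrecRel_iota_subset.comp
      (primrec₂_finiteOracle.comp Primrec.fst (Primrec.succ.comp Primrec.snd))
      primrec₂_finiteOracle
  exact (primrecPred_forall_lt (Primrec.list_length.comp Primrec.fst) hstep).of_eq fun _ =>
    antitone_iota_finiteOracle_iff.symm

theorem primrecPred_certifies {α : Type*} [Primcodable α] {k m : ℕ}
    {P : α → Fin m → OracleProgram k} {B : α → Fin (k + m) → ℕ} {D : α → Fin k → List ℕ × ℕ}
    {w : α → Fin m → ℕ × ℕ × ℕ} (hP : Primrec P) (hB : ∀ i, Primrec fun a => B a i)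
    (hD : Primrec D) (hw : Primrec w) :
    PrimrecPred fun a => Certifies (P a) (B a) (D a) (w a) := by
  have hlast (i : Fin k) : Primrec fun a => (D a i).2 := Primrec.snd.comp (primrec_apply hD i)
  have hout (j : Fin m) : Primrec fun a => (w a j).2.2 :=
    Primrec.snd.comp (Primrec.snd.comp (primrec_apply hw j))
  have horacle : Primrec fun p : α × Fin k × ℕ => finiteOracle (D p.1 p.2.1) p.2.2 :=
    primrec₂_finiteOracle.comp (Primrec.fin_app.comp (hD.comp Primrec.fst)
      (Primrec.fst.comp Primrec.snd)) (Primrec.snd.comp Primrec.snd)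
  have hrun (j : Fin m) : Primrec fun a =>
      (P a j).evalSteps (fun i => finiteOracle (D a i)) (w a j).1 (w a j).2.1 :=
    primrec_evalSteps horacle (primrec_apply hP j) (Primrec.fst.comp (primrec_apply hw j))
      (Primrec.fst.comp (Primrec.snd.comp (primrec_apply hw j)))
  refine PrimrecPred.and (primrecPred_forall_fin fun i => ?_) (primrecPred_forall_fin fun j => ?_)
  · exact (primrecPred_antitone_iota_finiteOracle.comp (primrec_apply hD i)).and
      ((primrecPred_iota_nonempty.comp (hlast i)).and
        (primrecRel_iota_subset.comp (hlast i) (hB _)))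
  · exact (Primrec.eq.comp (hrun j) (Primrec.option_some.comp (hout j))).and
      (primrecRel_iota_subset.comp (hout j) (hB _))

theorem PhysicalModel.KreiselPrograms.mem_meetingCodes_iff {k m : ℕ} {c : ℚ} (hc : 0 < c)
    {M : PhysicalModel (Fin (k + m) → ℝ) ℝ} {P : Fin m → OracleProgram k}
    (h : M.KreiselPrograms P) {s : ℕ} :
    s ∈ (CodedBasis.product fun _ => decimalIntervals c).meetingCodes M.states ↔
      ∃ q : (Fin (k + m) → ℕ × ℕ × ℕ) × (Fin k → List ℕ × ℕ) × (Fin m → ℕ × ℕ × ℕ),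
        (∀ i, HasDecimalEndpoints c (seqProj i s) (q.1 i)) ∧
          Certifies P (fun i => seqProj i s) q.2.1 q.2.2 := by
  have hdom : (∀ i : Fin (k + m), seqProj i s ∈ (decimalIntervals c).dom) ↔
      ∃ e : Fin (k + m) → ℕ × ℕ × ℕ, ∀ i, HasDecimalEndpoints c (seqProj i s) (e i) := by
    rw [← Classical.skolem]
    exact forall_congr' fun i => mem_decimalIntervals_dom_iff hc
  rw [CodedBasis.mem_meetingCodes_product_iff, hdom]
  refine (and_congr_right' (h.exists_mem_states_iff_exists_certifies fun i => seqProj i s)).trans ?_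
  exact ⟨fun ⟨⟨e, he⟩, D, w, hD⟩ => ⟨⟨e, D, w⟩, he, hD⟩,
    fun ⟨⟨e, D, w⟩, he, hD⟩ => ⟨⟨e, he⟩, D, w, hD⟩⟩

theorem exists_computable_code_dom_meetingCodes (k m : ℕ) {c : ℚ} (hc : 0 < c) :
    ∃ r : (Fin m → OracleProgram k) → Nat.Partrec.Code, Computable r ∧
      ∀ (M : PhysicalModel (Fin (k + m) → ℝ) ℝ) (P : Fin m → OracleProgram k),
        M.KreiselPrograms P → ∀ s, ((r P).eval s).Dom ↔
          s ∈ (CodedBasis.product fun _ => decimalIntervals c).meetingCodes M.states := by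
  have hcert : PrimrecRel fun (p : (Fin m → OracleProgram k) × ℕ)
      (q : (Fin (k + m) → ℕ × ℕ × ℕ) × (Fin k → List ℕ × ℕ) × (Fin m → ℕ × ℕ × ℕ)) =>
      (∀ i, HasDecimalEndpoints c (seqProj i p.2) (q.1 i)) ∧
        Certifies p.1 (fun i => seqProj i p.2) q.2.1 q.2.2 := by
    refine PrimrecPred.and (primrecPred_forall_fin fun i => ?_) ?_
    · exact (primrecRel_hasDecimalEndpoints hc).comp
        ((primrec_seqProj i).comp (Primrec.snd.comp Primrec.fst))
        (primrec_apply (Primrec.fst.comp Primrec.snd) i)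
    · exact primrecPred_certifies (Primrec.fst.comp Primrec.fst)
        (fun i => (primrec_seqProj i).comp (Primrec.snd.comp Primrec.fst))
        (Primrec.fst.comp (Primrec.snd.comp Primrec.snd))
        (Primrec.snd.comp (Primrec.snd.comp Primrec.snd))
  obtain ⟨r, hr, hdom⟩ := exists_computable_code_dom (rePred_exists hcert)
  exact ⟨r, hr, fun M P h s => (hdom P s).trans (h.mem_meetingCodes_iff hc).symm⟩

/-- The codes of the pairs of an input `s` of the program `r` and the greatest step bound `t` with
which `r` does not yet halt on `s`. Unlike the domain of `r` this set is decidable. -/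
def haltingTimes (r : Nat.Partrec.Code) : Set ℕ :=
  {w | r.evaln w.unpair.2 w.unpair.1 = none ∧ (r.evaln (w.unpair.2 + 1) w.unpair.1).isSome}

theorem primrecRel_mem_haltingTimes : PrimrecRel fun (r : Nat.Partrec.Code) w =>
    w ∈ haltingTimes r := by
  have hinput : Primrec fun p : Nat.Partrec.Code × ℕ => p.2.unpair.1 :=
    Primrec.fst.comp (Primrec.unpair.comp Primrec.snd)
  have htime : Primrec fun p : Nat.Partrec.Code × ℕ => p.2.unpair.2 :=
    Primrec.snd.comp (Primrec.unpair.comp Primrec.snd)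
  have hrun {t : Nat.Partrec.Code × ℕ → ℕ} (ht : Primrec t) :
      Primrec fun p : Nat.Partrec.Code × ℕ => p.1.evaln (t p) p.2.unpair.1 :=
    Nat.Partrec.Code.primrec_evaln.comp ((ht.pair Primrec.fst).pair hinput)
  exact (Primrec.eq.comp (hrun htime) (Primrec.const none)).and
    (Primrec.eq.comp (Primrec.option_isSome.comp (hrun (Primrec.succ.comp htime)))
      (Primrec.const true))

theorem exists_computable_code_mem_haltingTimes {α : Type*} [Primcodable α]
    {r : α → Nat.Partrec.Code} (hr : Computable r) :
    ∃ t : α → Nat.Partrec.Code, Computable t ∧ ∀ a w,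
      (w ∈ haltingTimes (r a) → (t a).eval w = Part.some 1) ∧
        (w ∉ haltingTimes (r a) → (t a).eval w = Part.some 0) :=
  exists_computable_code_indicator (p := fun p : α × ℕ => p.2 ∈ haltingTimes (r p.1))
    (computablePred_comp primrecRel_mem_haltingTimes.computablePred
      ((hr.comp Computable.fst).pair Computable.snd))

theorem bijOn_unpair_fst_haltingTimes (r : Nat.Partrec.Code) :
    BijOn (fun w => w.unpair.1) (haltingTimes r) {s | (r.eval s).Dom} := by
  have le_of_halts {w w' : ℕ} (hw : w ∈ haltingTimes r) (hw' : w' ∈ haltingTimes r)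
      (h : w.unpair.1 = w'.unpair.1) : w.unpair.2 ≤ w'.unpair.2 := by
    by_contra! hlt
    obtain ⟨v, hv⟩ := Option.isSome_iff_exists.1 hw'.2
    have hv' := Nat.Partrec.Code.evaln_mono (Nat.succ_le_of_lt hlt) hv
    rw [← h, hw.1] at hv'
    cases hv'
  refine ⟨fun w hw => ?_, fun w hw w' hw' h => ?_, fun s hs => ?_⟩
  · obtain ⟨v, hv⟩ := Option.isSome_iff_exists.1 hw.2
    exact Part.dom_iff_mem.2 ⟨v, Nat.Partrec.Code.evaln_sound hv⟩
  · rw [← Nat.pair_unpair w, ← Nat.pair_unpair w', show w.unpair.1 = w'.unpair.1 from h,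
      (le_of_halts hw hw' h).antisymm (le_of_halts hw' hw h.symm)]
  · obtain ⟨v, hv⟩ := Part.dom_iff_mem.1 hs
    obtain ⟨n, hn⟩ := Nat.Partrec.Code.evaln_complete.1 hv
    obtain ⟨t, hnot, ht⟩ := Nat.exists_not_and_succ_of_not_zero_of_exists
      (p := fun t => (r.evaln t s).isSome) (by simp [Nat.Partrec.Code.evaln])
      ⟨n, Option.isSome_iff_exists.2 ⟨v, hn⟩⟩
    exact ⟨Nat.pair s t, by
      simpa [haltingTimes] using And.intro (Option.not_isSome_iff_eq_none.1 hnot) ht, by simp⟩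

namespace PhysicalModel

/-- The model with set of states `T` whose observable quantities are those of `M`, read off through
`f`. -/
def comap {α β γ : Type} (M : PhysicalModel β γ) (f : α → β) (T : Set α) : PhysicalModel α γ where
  states := T
  observables := (· ∘ f) '' M.observables

/-- A model is isomorphic to its pullback along a map that is bijective between the states. Its
surjectivity onto the whole ambient type makes distinct observable quantities stay distinct. -/
noncomputable def isoComap {α β γ : Type} (M : PhysicalModel β γ) {f : α → β} {T : Set α}
    (hf : f.Surjective) (hT : BijOn f T M.states) : M.Iso (M.comap f T) where
  onStates := hT.equiv.symm
  onObservables := Equiv.Set.image (· ∘ f) M.observables hf.injective_comp_right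
  compat a s := congrArg a.1 (congrArg Subtype.val (hT.equiv.apply_symm_apply s)).symm

theorem isComputable_comap {M : PhysicalModel ℕ ℕ} (hM : ∀ a ∈ M.observables, Computable a)
    {f : ℕ → ℕ} (hf : Computable f) {T : Set ℕ} (hT : ComputablePred fun s => s ∈ T) :
    (M.comap f T).IsComputable := by
  refine ⟨hT, ?_⟩
  rintro _ ⟨a, ha, rfl⟩
  exact (hM a ha).comp hf

end PhysicalModel

/-- The basic representation of `M` by the codes of the decimal boxes that meet its states. -/
def decimalModel (c : ℚ) {n : ℕ} (M : PhysicalModel (Fin n → ℝ) ℝ) : PhysicalModel ℕ ℕ where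
  states := (CodedBasis.product fun _ => decimalIntervals c).meetingCodes M.states
  observables := range fun i : Fin n => seqProj i

theorem PhysicalModel.KreiselPrograms.isBasicRepresentation_decimalModel {k m : ℕ} {c : ℚ}
    (hc : 0 < c) {M : PhysicalModel (Fin (k + m) → ℝ) ℝ} {P : Fin m → OracleProgram k}
    (h : M.KreiselPrograms P) : (decimalModel c M).IsBasicRepresentation
      (fun _ => decimalIntervals c) M := by
  have hM : M.IsNormalForm := h.elim fun _ hψ => hψ.1.1
  refine ⟨hM, fun _ => isEffectiveTopology_decimalIntervals hc, ?_, rfl⟩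
  exact CodedBasis.isBasicRepresentation_meetingCodes
    (CodedBasis.isTopologicalBasis_product fun _ => isTopologicalBasis_decimalIntervals hc)
    (CodedBasis.product_basis_subset_range_coding fun _ =>
      decimalIntervals_basis_subset_range_coding c) h.isClosed_states

theorem surjective_unpair_fst : Function.Surjective fun w : ℕ => w.unpair.1 :=
  fun s => ⟨Nat.pair s 0, by simp⟩

/-- The pullback of `N` along the map that sends a halting time of `r` to its input. -/
def haltingModel (N : PhysicalModel ℕ ℕ) (r : Nat.Partrec.Code) : PhysicalModel ℕ ℕ :=
  N.comap (fun w => w.unpair.1) (haltingTimes r)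

theorem isComputable_haltingModel {N : PhysicalModel ℕ ℕ}
    (hN : ∀ a ∈ N.observables, Computable a) (r : Nat.Partrec.Code) :
    (haltingModel N r).IsComputable :=
  PhysicalModel.isComputable_comap hN (Primrec.fst.comp Primrec.unpair).to_comp
    (primrecRel_mem_haltingTimes.comp (Primrec.const r) Primrec.id).computablePred

/-- The pullback along the inputs of the halting times is an isomorphism when the domain of `r` is
the set of states of `N`. -/
noncomputable def isoHaltingModel {N : PhysicalModel ℕ ℕ} {r : Nat.Partrec.Code}
    (hr : ∀ s, (r.eval s).Dom ↔ s ∈ N.states) : N.Iso (haltingModel N r) :=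
  N.isoComap surjective_unpair_fst
    ((Set.ext hr : {s | (r.eval s).Dom} = N.states) ▸ bijOn_unpair_fst_haltingTimes r)

theorem computable_of_mem_observables_decimalModel {c : ℚ} {n : ℕ}
    {M : PhysicalModel (Fin n → ℝ) ℝ} : ∀ a ∈ (decimalModel c M).observables, Computable a := by
  rintro _ ⟨i, rfl⟩
  exact (primrec_seqProj i).to_comp

end CPM

/-- Models satisfying Kreisel's criterion on `ℝᵏ` have basic representations that are isomorphic
to computable physical models, and the construction is uniform: from programs for the functionals
of Kreisel's criterion one computes a program `r` whose domain is the set of states of the basic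
representation, a program `t` for the characteristic function of the set of states of the
computable physical model, and programs `b i` for its observable quantities. -/
theorem mainTheorem1 (k m : ℕ) (hm : 0 < m) (c : ℚ) (hc : 0 < c) :
    (∀ M : CPM.PhysicalModel (Fin (k + m) → ℝ) ℝ, M.SatisfiesKreisel →
      ∃ N C : CPM.PhysicalModel ℕ ℕ,
        CPM.PhysicalModel.IsBasicRepresentation (fun _ => CPM.decimalIntervals c) N M ∧
        C.IsComputable ∧ N.Isomorphic C) ∧
    ∃ (r t : (Fin m → CPM.OracleProgram k) → Nat.Partrec.Code)
      (b : (Fin m → CPM.OracleProgram k) → Fin (k + m) → Nat.Partrec.Code),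
      Computable r ∧ Computable t ∧ Computable b ∧
      ∀ (M : CPM.PhysicalModel (Fin (k + m) → ℝ) ℝ) (P : Fin m → CPM.OracleProgram k),
        M.KreiselPrograms P →
        ∃ N C : CPM.PhysicalModel ℕ ℕ,
          CPM.PhysicalModel.IsBasicRepresentation (fun _ => CPM.decimalIntervals c) N M ∧
          (∀ s, ((r P).eval s).Dom ↔ s ∈ N.states) ∧
          C.IsComputable ∧
          (∀ s, (s ∈ C.states → (t P).eval s = Part.some 1) ∧
            (s ∉ C.states → (t P).eval s = Part.some 0)) ∧
          ∃ e : CPM.PhysicalModel.Iso N C,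
            ∀ (i : Fin (k + m)) (a : N.observables), a.1 = CPM.seqProj i →
              ∀ s, (b P i).eval s = Part.some ((e.onObservables a).1 s) := by
  obtain ⟨r, hr, hr_dom⟩ := CPM.exists_computable_code_dom_meetingCodes k m hc
  obtain ⟨t, ht, ht_eval⟩ := CPM.exists_computable_code_mem_haltingTimes hr
  choose b hb using fun i : Fin (k + m) => Nat.Partrec.Code.exists_code.1 (Partrec.nat_iff.1
    ((CPM.primrec_seqProj i).comp (Primrec.fst.comp Primrec.unpair)).to_comp.partrec)
  have hcomputable (M : CPM.PhysicalModel (Fin (k + m) → ℝ) ℝ) (P) :=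
    CPM.isComputable_haltingModel
      (CPM.computable_of_mem_observables_decimalModel (c := c) (M := M)) (r P)
  refine ⟨fun M ⟨P, hP⟩ => ⟨_, _, hP.isBasicRepresentation_decimalModel hc, hcomputable M P,
    ⟨CPM.isoHaltingModel (hr_dom M P hP)⟩⟩, r, t, fun _ => b, hr, ht, Computable.const b,
    fun M P hP => ⟨_, _, hP.isBasicRepresentation_decimalModel hc, hr_dom M P hP, hcomputable M P,
      ht_eval P, CPM.isoHaltingModel (hr_dom M P hP), fun i a ha s => ?_⟩⟩
  rw [hb]
  exact congrArg (fun f => Part.some (f s.unpair.1)) ha.symm
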